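/- **Setting.** Let $G=(I\cup J,E)$ be a finite simple bipartite graph with classes $I$ (sellers) and $J$ (buyers), let $b:I\cup J\to\mathbb Z_{\ge 0}$ be vertex capacities and $w:E\to\mathbb R_{\ge 0}$ edge weights (an instance of the multiple partners assignment problem). *Stable solutions.* A $b$-matching is a set $M\subseteq E$ with at most $b(i)$ edges at each player $i$. A *solution* is a pair $(M,p)$ of a $b$-matching $M$ and $p:(I\cup J)^2\to\mathbb R_{\ge 0}$ with $p(i,j)+p(j,i)=w(ij)$ for $ij\in M$ and $p(i,j)=p(j,i)=0$ for $ij\notin M$. Let $u_p(i)=0$ if $i$ is in fewer than $b(i)$ edges of $M$, and otherwise $u_p(i)=\min\{p(i,j): ij\in M\}$ (which is $+\infty$ if $b(i)=0$). A solution is *stable* if $u_p(i)+u_p(j)\ge w(ij)$ for all $ij\in E\setminus M$. Two stable solutions $(M,p)$, $(M',p')$ are *equivalent* if $u_p=u_{p'}$; $p(i,j)=p'(i,j)$ and $p(j,i)=p'(j,i)$ for $ij\in M\cap M'$; $p(i,j)=u_p(i)$ and $p(j,i)=u_p(j)$ for $ij\in M\setminus M'$; and $p'(i,j)=u_{p'}(i)$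 and $p'(j,i)=u_{p'}(j)$ for $ij\in M'\setminus M$. The total payoff of $i$ is $\sum_{j:ij\in E}p(i,j)$. *Competitive equilibria.* Each seller $i$ owns $b(i)$ items $i^1,\dots,i^{b(i)}$. A bundle for buyer $j$ is a set of at most $b(j)$ items of sellers adjacent to $j$, with at most one item of each seller. A price vector assigns a price $q(i^s)\ge 0$ to every item. A *competitive equilibrium outcome* is a pair $(B,q)$ of pairwise disjoint bundles $B(j)$, $j\in J$, and a price vector $q$ such that each $B(j)$ maximizes $\sum_{i^s\in T}(w(ij)-q(i^s))$ over all bundles $T$ for $j$, and every item in no $B(j)$ has price $0$. It induces the pair $(M_B,p_{B,q})$, where $M_B$ is the set of edges $ij$ with $i^s\in B(j)$ for some $s$; for such $i^s$ one puts $p_{B,q}(i,j)=q(i^s)$ and $p_{B,q}(j,i)=w(ij)-q(i^s)$, and all other payoffs are $0$. A stable solution (respectively a competitive equilibrium outcome) is *optimal* for a set $S$ of players if no stable solution (respectively no competitive equilibrium outcome) gives a strictly larger total payoff to some player of $S$. *Buyer-optimal* means optimal for $J$, *seller-optimal* means optimal for $I$. **Theorem.** 1. Two competitive equilibrium outcomes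 induce equivalent payoffs if and only if they have the same price vector. For two such outcomes $(B,q)$, $(B',q')$ one has $q\le q'$ (componentwise) if and only if every seller's total payoff in $(B,q)$ is at most that in $(B',q')$, and then every buyer's total payoff in $(B,q)$ is at least that in $(B',q')$. With this order, the competitive equilibrium outcomes (up to equivalence), that is, the set $Q$ of their price vectors ordered componentwise, form a complete lattice: every subset of $Q$ has a supremum and an infimum in $Q$. The componentwise maximum and minimum of two elements of $Q$ belong to $Q$. 2. There are unique optimal outcomes for each side: $Q$ has a least element $q_0$ and a greatest element $q_1$, and a competitive equilibrium outcome $(B,q)$ is buyer-optimal if and only if $q=q_0$, and seller-optimal if and only if $q=q_1$. 3. For every competitive equilibrium outcome $(B,q)$, the pair $(M_B,p_{B,q})$ is a stable solution. 4. A buyer-optimal stable solution exists, and every buyer-optimal stable solution $(M,p)$ is equivalent to $(M_B,p_{B,q})$ for every buyer-optimal competitive equilibrium outcome $(B,q)$. -/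

import Mathlib

/-- A multiple partners matching game `(G, b, w)`: a simple graph on the player set `V`,
vertex capacities `b`, and edge weights `w` that are nonnegative on the edges
(the values of `w` outside the edge set are irrelevant). -/
structure MatchingGame (V : Type*) where
  G : SimpleGraph V
  b : V → ℕ
  w : Sym2 V → ℝ
  w_nonneg : ∀ e ∈ G.edgeSet, 0 ≤ w e

namespace MatchingGame

variable {V : Type*} [Fintype V]

open Classical in
/-- The partners of player `i` under `M`. A set of edges on `V` is given as a simple graph `M`
on `V`. -/
noncomputable def partners (M : SimpleGraph V) (i : V) : Finset V :=
  Finset.univ.filter fun j => M.Adj i j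

/-- `M` is a `b`-matching: a set of edges of `G` with at most `b i` edges at each player `i`. -/
def IsBMatching (A : MatchingGame V) (M : SimpleGraph V) : Prop :=
  M ≤ A.G ∧ ∀ i, (partners M i).card ≤ A.b i

/-- `(M, p)` is a solution: `M` is a `b`-matching and `p` is a payoff vector compatible
with `M`. -/
structure IsSolution (A : MatchingGame V) (M : SimpleGraph V) (p : V → V → ℝ) : Prop where
  isBMatching : A.IsBMatching M
  nonneg : ∀ i j, 0 ≤ p i j
  add_eq : ∀ i j, M.Adj i j → p i j + p j i = A.w s(i, j)
  eq_zero : ∀ i j, ¬ M.Adj i j → p i j = 0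

/-- The utility of player `i`: zero if `i` is unsaturated, and otherwise the minimum of the
payoffs `p i j` over the partners `j` of `i`. If `b i = 0` this is a minimum over the empty set,
which is `⊤`: a player without capacity cannot take part in a new coalition. -/
noncomputable def utility (A : MatchingGame V) (M : SimpleGraph V) (p : V → V → ℝ) (i : V) :
    WithTop ℝ :=
  if (partners M i).card < A.b i then 0
  else (partners M i).inf fun j => ((p i j : ℝ) : WithTop ℝ)

/-- `(M, p)` is a stable solution: a solution without blocking pairs. -/
structure IsStable (A : MatchingGame V) (M : SimpleGraph V) (p : V → V → ℝ) : Prop where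
  isSolution : A.IsSolution M p
  not_blocking : ∀ i j, A.G.Adj i j → ¬ M.Adj i j →
    ((A.w s(i, j) : ℝ) : WithTop ℝ) ≤ A.utility M p i + A.utility M p j

/-- Equivalence of the payoffs of two solutions `(M, p)` and `(M', p')`. -/
structure Equivalent (A : MatchingGame V) (M : SimpleGraph V) (p : V → V → ℝ)
    (M' : SimpleGraph V) (p' : V → V → ℝ) : Prop where
  utility_eq : ∀ i, A.utility M p i = A.utility M' p' i
  both : ∀ i j, M.Adj i j → M'.Adj i j → p i j = p' i j
  left : ∀ i j, M.Adj i j → ¬ M'.Adj i j → ((p i j : ℝ) : WithTop ℝ) = A.utility M p i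
  right : ∀ i j, M'.Adj i j → ¬ M.Adj i j → ((p' i j : ℝ) : WithTop ℝ) = A.utility M' p' i

open Classical in
/-- The total payoff of player `i`. -/
noncomputable def totalPayoff (A : MatchingGame V) (p : V → V → ℝ) (i : V) : ℝ :=
  ∑ j ∈ Finset.univ.filter (fun j => A.G.Adj i j), p i j

/-- `(M, p)` is a stable solution that is optimal for the players in `S`: no stable solution
gives a larger total payoff to some player in `S`. -/
def IsOptimalStable (A : MatchingGame V) (S : Finset V) (M : SimpleGraph V) (p : V → V → ℝ) :
    Prop :=
  A.IsStable M p ∧ ¬ ∃ M' p', A.IsStable M' p' ∧ ∃ i ∈ S, A.totalPayoff p i < A.totalPayoff p' i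

end MatchingGame

/-- An instance of the multiple partners assignment problem: a multiple partners matching game
on a bipartite graph with partition classes `sellers` and `buyers`. -/
structure MPA (V : Type*) extends MatchingGame V where
  sellers : Finset V
  buyers : Finset V
  cover : ∀ v, v ∈ sellers ∨ v ∈ buyers
  bipartite : G.IsBipartiteWith (sellers : Set V) (buyers : Set V)

namespace MPA

variable {V : Type*}

/-- The items on the market: the pair `⟨i, s⟩` is the copy number `s` of the good of seller `i`,
who owns `b i` copies. -/
abbrev Item (A : MPA V) : Type _ := Σ i : {i // i ∈ A.sellers}, Fin (A.b i)

/-- `T` is a bundle for buyer `j`: a set of at most `b j` items of sellers adjacent to `j`,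
with at most one item of every seller. -/
structure IsBundle (A : MPA V) (j : {j // j ∈ A.buyers}) (T : Finset A.Item) : Prop where
  adj : ∀ x ∈ T, A.G.Adj x.1 j
  one_per_seller : ∀ x ∈ T, ∀ y ∈ T, x.1 = y.1 → x = y
  card_le : T.card ≤ A.b j

/-- The total payoff for buyer `j` of the set of items `T` at prices `q`. -/
noncomputable def bundlePayoff (A : MPA V) (q : A.Item → ℝ) (j : {j // j ∈ A.buyers})
    (T : Finset A.Item) : ℝ :=
  ∑ x ∈ T, (A.w s((x.1 : V), (j : V)) - q x)

/-- The demand set of buyer `j` at prices `q`: the bundles that maximize the total payoff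
for `j`. -/
def demand (A : MPA V) (q : A.Item → ℝ) (j : {j // j ∈ A.buyers}) : Set (Finset A.Item) :=
  {T | A.IsBundle j T ∧ ∀ T', A.IsBundle j T' → A.bundlePayoff q j T' ≤ A.bundlePayoff q j T}

/-- `(B, q)` is a competitive equilibrium outcome. -/
structure IsCompetitiveEquilibrium (A : MPA V) (B : {j // j ∈ A.buyers} → Finset A.Item)
    (q : A.Item → ℝ) : Prop where
  price_nonneg : ∀ x, 0 ≤ q x
  mem_demand : ∀ j, B j ∈ A.demand q j
  unsold : ∀ x, (∀ j, x ∉ B j) → q x = 0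
  disjoint : ∀ j k, j ≠ k → Disjoint (B j) (B k)

/-- The price vectors of the competitive equilibrium outcomes. -/
def equilibriumPrices (A : MPA V) : Set (A.Item → ℝ) :=
  {q | ∃ B, A.IsCompetitiveEquilibrium B q}

/-- The set of edges `ij` such that buyer `j` obtains an item of seller `i`. -/
def matching (A : MPA V) (B : {j // j ∈ A.buyers} → Finset A.Item) : SimpleGraph V :=
  SimpleGraph.fromRel fun u v => ∃ j : {j // j ∈ A.buyers}, ∃ x ∈ B j, (x.1 : V) = u ∧ (j : V) = v

open Classical in
/-- The payoff vector of an outcome `(B, q)`: if `j` obtains the item `x` of seller `i`, then `i`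
gets `q x` from `j`, and `j` gets `w(ij) - q x` from `i`; all other payoffs are zero.
(If each `B j` is a bundle then at most one summand is nonzero.) -/
noncomputable def payoff (A : MPA V) (B : {j // j ∈ A.buyers} → Finset A.Item)
    (q : A.Item → ℝ) (u v : V) : ℝ :=
  ∑ j, ∑ x ∈ B j,
    ((if (x.1 : V) = u ∧ (j : V) = v then q x else 0) +
      (if (j : V) = u ∧ (x.1 : V) = v then A.w s(u, v) - q x else 0))

/-- `(B, q)` is a competitive equilibrium outcome that is optimal for the players in `S`: no
competitive equilibrium outcome gives a larger total payoff to some player in `S`. -/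
def IsOptimalEquilibrium [Fintype V] (A : MPA V) (S : Finset V)
    (B : {j // j ∈ A.buyers} → Finset A.Item) (q : A.Item → ℝ) : Prop :=
  A.IsCompetitiveEquilibrium B q ∧ ¬ ∃ B' q', A.IsCompetitiveEquilibrium B' q' ∧
    ∃ i ∈ S, A.totalPayoff (A.payoff B q) i < A.totalPayoff (A.payoff B' q') i

end MPA

/-! Everything reduces to uniform prices. In an equilibrium all copies of a seller's good cost the
same, and a bundle is optimal once no change of a single item improves it (`mem_demand_iff`). So an
outcome amounts to a `b`-matching with one price per seller that admits no such improvement: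
`IsPricing`. These data produce equilibria with the same matching
(`IsPricing.exists_isCompetitiveEquilibrium`) and stable solutions (`IsPricing.isStable`).
Conversely, in a stable solution the sellers' utilities are such prices (`isPricing_of_isStable`):
every seller lowers all its payoffs to its utility, which can only help the buyers.

Existence is linear programming duality by hand: for a `b`-matching of maximum weight the residual
network has no negative cycle, and its potentials are the prices (`exists_isPricing`).

For the lattice, payments cancel in the total surplus, so all equilibrium allocations have equal
welfare and each is supported by all equilibrium prices (`of_prices`). With the allocation fixed,
the prices are cut out by bounds on single prices and on differences of two prices, a system closed
under componentwise suprema and infima.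

Sellers' payoffs are multiples of prices, and buyers gain from lower prices, so the extreme prices
are the optimal ones. A buyer-optimal stable solution must agree with the equilibrium that dominates
it for the buyers, hence has the least prices. -/

/-! ### Closed walks, permutations and potentials. -/

/-- The cost of the walk that starts in `a`, visits the vertices of `l`, and ends in `b`. -/
def walkCost {N : Type*} (c : N → N → ℝ) : N → List N → N → ℝ
  | a, [], b => c a b
  | a, d :: l, b => c a d + walkCost c d l b

section Potential

variable {N : Type*} (c : N → N → ℝ)

theorem walkCost_append (l l' : List N) (a d b : N) :
    walkCost c a (l ++ d :: l') b = walkCost c a l d + walkCost c d l' b := by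
  induction l generalizing a with
  | nil => rfl
  | cons e l ih => simp only [List.cons_append, walkCost, ih, add_assoc]

theorem walkCost_eq_sum (l : List N) (a b : N) :
    walkCost c a l b = ((a :: l).zipWith c (l ++ [b])).sum := by
  induction l generalizing a with
  | nil => simp [walkCost]
  | cons e l ih => simp [walkCost, ih]

/-- A closed walk without repetitions is a cyclic permutation; the vertices off the walk are fixed
and cost nothing by `hc`. -/
theorem walkCost_eq_sum_formPerm [Fintype N] [DecidableEq N] (hc : ∀ a, c a a = 0) (a : N)
    (l : List N) (h : (a :: l).Nodup) :
    walkCost c a l a = ∑ x, c x ((a :: l).formPerm x) := by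
  have key : ((a :: l).map fun x => c x ((a :: l).formPerm x)).sum = walkCost c a l a := by
    rw [walkCost_eq_sum]
    congr 1
    apply List.ext_getElem
    · simp
    · intro k h1 h2
      simp only [List.getElem_map, List.getElem_zipWith]
      rw [List.formPerm_apply_getElem _ h]
      congr 1
      have hk : k < l.length + 1 := by simpa using h1
      rcases Nat.lt_succ_iff_lt_or_eq.mp hk with h3 | h3
      · simp [Nat.mod_eq_of_lt (Nat.succ_lt_succ h3), List.getElem_append_left h3]
      · subst h3
        simp
  rw [← key, ← List.sum_toFinset _ h]
  apply Finset.sum_subset (Finset.subset_univ _)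
  intro x _ hx
  rw [List.formPerm_apply_of_notMem (by simpa using hx), hc]

/-- If no permutation has negative cost, then no closed walk has negative cost. -/
theorem walkCost_nonneg [Fintype N] (hc : ∀ a, c a a = 0)
    (h : ∀ π : Equiv.Perm N, 0 ≤ ∑ a, c a (π a)) (a : N) (l : List N) :
    0 ≤ walkCost c a l a := by
  classical
  induction hn : l.length using Nat.strong_induction_on generalizing a l with
  | _ n ih =>
    subst hn
    by_cases hd : (a :: l).Nodup
    · rw [walkCost_eq_sum_formPerm c hc a l hd]
      exact h _
    -- At a repeated vertex the closed walk splits into two shorter closed walks.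
    · rw [List.nodup_cons, not_and_or, not_not] at hd
      rcases hd with hd | hd
      · obtain ⟨s, t, rfl⟩ := List.append_of_mem hd
        rw [walkCost_append]
        exact add_nonneg (ih _ (by simp) _ _ rfl) (ih _ (by simp; omega) _ _ rfl)
      · rw [← List.exists_duplicate_iff_not_nodup] at hd
        obtain ⟨d, hd⟩ := hd
        rw [List.duplicate_iff_sublist] at hd
        obtain ⟨s, t, rfl, h1, h2⟩ := List.cons_sublist_iff.mp hd
        obtain ⟨s₁, s₂, rfl⟩ := List.append_of_mem h1
        obtain ⟨t₁, t₂, rfl⟩ := List.append_of_mem (List.singleton_sublist.mp h2)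
        have e1 := ih _ (by simp; omega) d (s₂ ++ t₁) rfl
        have e2 := ih _ (by simp; omega) a (s₁ ++ d :: t₂) rfl
        rw [walkCost_append] at e2
        have e3 : s₁ ++ d :: s₂ ++ (t₁ ++ d :: t₂) = s₁ ++ d :: ((s₂ ++ t₁) ++ d :: t₂) := by simp
        rw [e3, walkCost_append, walkCost_append]
        linarith

/-- Potentials exist if no permutation has negative cost. -/
theorem exists_potential [Fintype N] (hc : ∀ a, c a a = 0)
    (h : ∀ π : Equiv.Perm N, 0 ≤ ∑ a, c a (π a)) :
    ∃ x : N → ℝ, ∀ a b, x a ≤ x b + c a b := by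
  rcases isEmpty_or_nonempty N with hN | ⟨⟨r⟩⟩
  · exact ⟨fun _ => 0, fun a => hN.elim a⟩
  -- The potential is the distance to a fixed root `r`. Closing a walk with the arc from `r` to `a`
  -- bounds its cost below by `-c r a`.
  · refine ⟨fun a => ⨅ l : List N, walkCost c a l r, fun a b => ?_⟩
    have hb : BddBelow (Set.range fun l : List N => walkCost c a l r) := by
      refine ⟨-c r a, ?_⟩
      rintro _ ⟨l, rfl⟩
      have := walkCost_nonneg c hc h r (a :: l)
      simp only [walkCost] at this
      simp only
      linarith
    rw [← sub_le_iff_le_add]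
    refine le_ciInf fun l => ?_
    have := ciInf_le hb (b :: l)
    simp only [walkCost] at this
    linarith

/-- Potentials exist for the arcs of a relation `R` if no permutation along `R` has negative
cost. -/
theorem exists_potential_of_rel [Fintype N] [DecidableEq N] (R : N → N → Prop)
    (h : ∀ π : Equiv.Perm N, (∀ a, π a ≠ a → R a (π a)) →
      0 ≤ ∑ a, if π a = a then 0 else c a (π a)) :
    ∃ x : N → ℝ, ∀ a b, a ≠ b → R a b → x a ≤ x b + c a b := by
  classical
  -- Arcs outside `R` receive the cost `L`. A permutation using one of them has nonnegative cost,
  -- because the arcs of `R` that it uses contribute at least `-L`.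
  set L : ℝ := ∑ a, ∑ b, |c a b| with hL
  have hle : ∀ a b, |c a b| ≤ ∑ b, |c a b| := fun a b =>
    Finset.single_le_sum (f := fun b => |c a b|) (fun _ _ => abs_nonneg _) (Finset.mem_univ b)
  have hL0 : 0 ≤ L := Finset.sum_nonneg fun a _ => Finset.sum_nonneg fun b _ => abs_nonneg _
  obtain ⟨x, hx⟩ := exists_potential
    (fun a b => if b = a then 0 else if R a b then c a b else L) (by simp) (by
    intro π
    by_cases hπ : ∀ a, π a ≠ a → R a (π a)
    · refine (h π hπ).trans_eq (Finset.sum_congr rfl fun a _ => ?_)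
      by_cases ha : π a = a
      · simp [ha]
      · simp [ha, hπ a ha]
    · push Not at hπ
      obtain ⟨a₀, h1, h2⟩ := hπ
      have key : ∀ a, (if a = a₀ then L else 0) - ∑ b, |c a b| ≤
          if π a = a then 0 else if R a (π a) then c a (π a) else L := by
        intro a
        have h0 : 0 ≤ ∑ b, |c a b| := Finset.sum_nonneg fun b _ => abs_nonneg _
        have h3 := (neg_le_of_abs_le (hle a (π a)))
        by_cases ha : a = a₀
        · subst ha
          simp [h1, h2, h0]
        · simp only [ha, if_false]
          split_ifs <;> linarith
      have := Finset.sum_le_sum fun a (_ : a ∈ Finset.univ) => key a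
      rw [Finset.sum_sub_distrib, Finset.sum_ite_eq' Finset.univ a₀, if_pos (Finset.mem_univ _),
        ← hL, sub_self] at this
      exact this)
  refine ⟨x, fun a b hab hR => ?_⟩
  have := hx a b
  rwa [if_neg (Ne.symm hab), if_pos hR] at this

end Potential

/-! ### Maximum weight `b`-matchings and prices from the residual network. -/

section

open MatchingGame

theorem MatchingGame.mem_partners {V : Type*} [Fintype V] {M : SimpleGraph V} {i j : V} :
    j ∈ partners M i ↔ M.Adj i j := by
  simp [partners]

namespace MPA

section Roles

variable {V : Type*} {A : MPA V}

theorem notMem_buyers {v : V} (h : v ∈ A.sellers) : v ∉ A.buyers := fun h' =>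
  Set.disjoint_left.mp A.bipartite.disjoint (Finset.mem_coe.mpr h) (Finset.mem_coe.mpr h')

theorem notMem_sellers {v : V} (h : v ∈ A.buyers) : v ∉ A.sellers := fun h' =>
  notMem_buyers h' h

theorem mem_buyers_of_adj {i j : V} (h : A.G.Adj i j) (hi : i ∈ A.sellers) : j ∈ A.buyers := by
  rcases A.bipartite.mem_of_adj h with h | h
  · exact Finset.mem_coe.mp h.2
  · exact absurd (Finset.mem_coe.mp h.1) (notMem_buyers hi)

theorem mem_sellers_of_adj {i j : V} (h : A.G.Adj i j) (hi : i ∈ A.buyers) : j ∈ A.sellers := by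
  rcases A.bipartite.mem_of_adj h with h | h
  · exact absurd (Finset.mem_coe.mp h.1) (notMem_sellers hi)
  · exact Finset.mem_coe.mp h.2

theorem sum_eq_sellers_add_buyers [Fintype V] (A : MPA V) (f : V → ℝ) :
    ∑ v, f v = ∑ i ∈ A.sellers, f i + ∑ j ∈ A.buyers, f j := by
  classical
  rw [← Finset.sum_union (Finset.disjoint_left.mpr fun _ => notMem_buyers)]
  refine Finset.sum_congr (Finset.ext fun v => ?_) fun _ _ => rfl
  simpa using A.cover v

end Roles

variable {V : Type*} [Fintype V]

/-- `(M, u)` is a `b`-matching with uniform prices `u i` for the sellers `i`, such that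
`(M, u)` admits no improvement for a buyer. -/
structure IsPricing (A : MPA V) (M : SimpleGraph V) (u : V → ℝ) : Prop where
  isBMatching : A.IsBMatching M
  nonneg : ∀ i ∈ A.sellers, 0 ≤ u i
  unsaturated : ∀ i ∈ A.sellers, (partners M i).card < A.b i → u i = 0
  le_weight : ∀ i ∈ A.sellers, ∀ j, M.Adj i j → u i ≤ A.w s(i, j)
  swap : ∀ i ∈ A.sellers, ∀ k ∈ A.sellers, ∀ j, M.Adj i j → A.G.Adj k j → ¬ M.Adj k j →
    0 < A.b k → u i + A.w s(k, j) ≤ u k + A.w s(i, j)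
  add : ∀ k ∈ A.sellers, ∀ j, A.G.Adj k j → ¬ M.Adj k j → 0 < A.b k →
    (partners M j).card < A.b j → A.w s(k, j) ≤ u k

/-- The arcs of the residual network of the `b`-matching `M`, with `none` as root. -/
def Residual (A : MPA V) (M : SimpleGraph V) : Option V → Option V → Prop
  | some a, some b => (a ∈ A.sellers ∧ M.Adj a b) ∨ (a ∈ A.buyers ∧ A.G.Adj a b ∧ ¬ M.Adj a b)
  | none, some a => a ∈ A.sellers ∨ (a ∈ A.buyers ∧ (partners M a).card < A.b a)
  | some a, none => a ∈ A.buyers ∨ (a ∈ A.sellers ∧ (partners M a).card < A.b a)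
  | none, none => False

open Classical in
/-- The costs of the arcs of the residual network. -/
noncomputable def residualCost (A : MPA V) : Option V → Option V → ℝ
  | some a, some b => if a ∈ A.sellers then A.w s(a, b) else -A.w s(a, b)
  | _, _ => 0

open Classical in
/-- The weight of a set `M` of edges. -/
noncomputable def weight (A : MPA V) (M : SimpleGraph V) : ℝ :=
  ∑ i ∈ A.sellers, ∑ j ∈ A.buyers, if M.Adj i j then A.w s(i, j) else 0

/-- The symmetric difference of `M` and the set of edges along which `π` moves a vertex. -/
def exchange (A : MPA V) (M : SimpleGraph V) (π : Equiv.Perm (Option V)) : SimpleGraph V where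
  Adj a b := A.G.Adj a b ∧
    ((M.Adj a b ∧ π (some a) ≠ some b ∧ π (some b) ≠ some a) ∨
      (¬ M.Adj a b ∧ (π (some a) = some b ∨ π (some b) = some a)))
  symm := ⟨fun a b h => by rw [A.G.adj_comm, M.adj_comm]; tauto⟩
  loopless := ⟨fun a h => A.G.loopless.irrefl a h.1⟩

section Exchange

variable {A : MPA V} {M M' : SimpleGraph V}

/-- Here `f` encodes the partner that `a` loses and `g` the one it gains; `none` stands for the
root. A gain is paid for by a loss or by spare capacity. -/
theorem card_partners_le_of_exchange {a : V} (hM : A.IsBMatching M) {f g : Option V}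
    (h : ∀ x, M'.Adj a x → (M.Adj a x ∧ f ≠ some x) ∨ g = some x ∧ x ≠ a)
    (hg : ∀ y, g = some y → y ≠ a →
      (∃ z, M.Adj a z ∧ f = some z) ∨ (partners M a).card < A.b a) :
    (partners M' a).card ≤ A.b a := by
  classical
  by_cases hy : ∃ y, g = some y ∧ y ≠ a
  · obtain ⟨y, rfl, hya⟩ := hy
    rcases hg y rfl hya with ⟨z, hz, rfl⟩ | hlt
    · have hsub : partners M' a ⊆ insert y ((partners M a).erase z) := by
        intro x hx
        rcases h x (mem_partners.mp hx) with ⟨h1, h2⟩ | ⟨h1, -⟩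
        · refine Finset.mem_insert_of_mem (Finset.mem_erase.mpr ⟨?_, mem_partners.mpr h1⟩)
          rintro rfl
          exact h2 rfl
        · rw [Option.some.inj h1]
          exact Finset.mem_insert_self _ _
      have h1 := Finset.card_le_card hsub
      have h2 := Finset.card_insert_le y ((partners M a).erase z)
      have h3 := Finset.card_erase_add_one (mem_partners.mpr hz)
      have h4 := hM.2 a
      omega
    · have hsub : partners M' a ⊆ insert y (partners M a) := by
        intro x hx
        rcases h x (mem_partners.mp hx) with ⟨h1, -⟩ | ⟨h1, -⟩
        · exact Finset.mem_insert_of_mem (mem_partners.mpr h1)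
        · rw [Option.some.inj h1]
          exact Finset.mem_insert_self _ _
      have h1 := Finset.card_le_card hsub
      have h2 := Finset.card_insert_le y (partners M a)
      omega
  · refine (Finset.card_le_card fun x hx => ?_).trans (hM.2 a)
    rcases h x (mem_partners.mp hx) with ⟨h1, -⟩ | h1
    · exact mem_partners.mpr h1
    · exact absurd ⟨x, h1⟩ hy

theorem adj_of_perm_seller {π : Equiv.Perm (Option V)}
    (hπ : ∀ a, π a ≠ a → A.Residual M a (π a)) {i x : V} (hi : i ∈ A.sellers) (hx : x ≠ i)
    (h : π (some i) = some x) : M.Adj i x := by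
  have h1 := hπ (some i) (by rw [h]; simpa using hx)
  rw [h] at h1
  rcases h1 with h1 | h1
  · exact h1.2
  · exact absurd h1.1 (notMem_buyers hi)

theorem not_adj_of_perm_buyer {π : Equiv.Perm (Option V)}
    (hπ : ∀ a, π a ≠ a → A.Residual M a (π a)) {j x : V} (hj : j ∈ A.buyers) (hx : x ≠ j)
    (h : π (some j) = some x) : ¬ M.Adj j x := by
  have h1 := hπ (some j) (by rw [h]; simpa using hx)
  rw [h] at h1
  rcases h1 with h1 | h1
  · exact absurd h1.1 (notMem_sellers hj)
  · exact h1.2.2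

/-- A seller loses the partner on its outgoing arc of `π` and gains the one on its incoming arc; for
a buyer the roles are reversed. When the losing arc joins the vertex to the root, the residual
network guarantees spare capacity. -/
theorem isBMatching_exchange (hM : A.IsBMatching M) {π : Equiv.Perm (Option V)}
    (hπ : ∀ a, π a ≠ a → A.Residual M a (π a)) : A.IsBMatching (A.exchange M π) := by
  refine ⟨fun a b h => h.1, fun a => ?_⟩
  rcases A.cover a with ha | ha
  · refine card_partners_le_of_exchange hM (f := π (some a)) (g := π.symm (some a)) ?_ ?_
    · rintro x ⟨hG, ⟨h1, h2, -⟩ | ⟨h1, h2 | h2⟩⟩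
      · exact Or.inl ⟨h1, h2⟩
      · exact absurd (adj_of_perm_seller hπ ha hG.ne' h2) h1
      · exact Or.inr ⟨by rw [← h2, Equiv.symm_apply_apply], hG.ne'⟩
    · intro y hy hya
      rw [Equiv.symm_apply_eq] at hy
      have hne : π (some a) ≠ some a := fun h =>
        hya (Option.some.inj (π.injective (hy.symm.trans h.symm)))
      have h1 := hπ _ hne
      rcases hz : π (some a) with _ | z
      · rw [hz] at h1
        rcases h1 with h1 | h1
        · exact absurd h1 (notMem_buyers ha)
        · exact Or.inr h1.2
      · refine Or.inl ⟨z, adj_of_perm_seller hπ ha ?_ hz, rfl⟩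
        rintro rfl
        exact hne hz
  · refine card_partners_le_of_exchange hM (f := π.symm (some a)) (g := π (some a)) ?_ ?_
    · rintro x ⟨hG, ⟨h1, -, h2⟩ | ⟨h1, h2 | h2⟩⟩
      · refine Or.inl ⟨h1, fun h => h2 ?_⟩
        rw [← h, Equiv.apply_symm_apply]
      · exact Or.inr ⟨h2, hG.ne'⟩
      · exact absurd (adj_of_perm_seller hπ (mem_sellers_of_adj hG ha) hG.ne h2).symm h1
    · intro y hy hya
      rcases hz : π.symm (some a) with _ | z
      · rw [Equiv.symm_apply_eq] at hz
        have h1 := hπ none (by simp [← hz])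
        rw [← hz] at h1
        rcases h1 with h1 | h1
        · exact absurd h1 (notMem_sellers ha)
        · exact Or.inr h1.2
      · rw [Equiv.symm_apply_eq] at hz
        have hza : z ≠ a := by
          rintro rfl
          exact hya (Option.some.inj (hy.symm.trans hz.symm))
        have h1 := hπ (some z) (by rw [← hz]; simpa using hza.symm)
        rw [← hz] at h1
        rcases h1 with h1 | h1
        · exact Or.inl ⟨z, h1.2.symm, rfl⟩
        · exact absurd (mem_sellers_of_adj h1.2.1 h1.1) (notMem_sellers ha)

/-- Arcs leaving sellers remove matched edges at cost `w`, arcs leaving buyers add unmatched edges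
at cost `-w`, and arcs at the root are free. No edge is used in both directions. -/
theorem weight_sub_weight_exchange [DecidableEq (Option V)] (hM : A.IsBMatching M)
    {π : Equiv.Perm (Option V)} (hπ : ∀ a, π a ≠ a → A.Residual M a (π a)) :
    ∑ a, (if π a = a then 0 else A.residualCost a (π a)) =
      A.weight M - A.weight (A.exchange M π) := by
  classical
  have hI : ∀ i ∈ A.sellers,
      (if π (some i) = some i then 0 else A.residualCost (some i) (π (some i))) =
        ∑ j ∈ A.buyers, if π (some i) = some j then A.w s(i, j) else 0 := by
    intro i hi
    rcases hz : π (some i) with _ | z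
    · simp [residualCost]
    · by_cases hzi : z = i
      · subst hzi
        rw [if_pos rfl, eq_comm]
        refine Finset.sum_eq_zero fun j hj => if_neg fun h => ?_
        exact notMem_buyers hi (Option.some.inj h ▸ hj)
      · have hadj := adj_of_perm_seller hπ hi hzi hz
        have hzJ := mem_buyers_of_adj (hM.1 hadj) hi
        rw [if_neg (by simpa using hzi), Finset.sum_eq_single_of_mem z hzJ, if_pos rfl]
        · simp [residualCost, hi]
        · intro b _ hb
          exact if_neg fun h => hb (Option.some.inj h).symm
  have hJ : ∀ j ∈ A.buyers,
      (if π (some j) = some j then 0 else A.residualCost (some j) (π (some j))) =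
        ∑ i ∈ A.sellers, if π (some j) = some i then -A.w s(i, j) else 0 := by
    intro j hj
    rcases hz : π (some j) with _ | z
    · simp [residualCost]
    · by_cases hzi : z = j
      · subst hzi
        rw [if_pos rfl, eq_comm]
        refine Finset.sum_eq_zero fun i hi => if_neg fun h => ?_
        exact notMem_buyers hi (Option.some.inj h ▸ hj)
      · have h1 := hπ (some j) (by rw [hz]; simpa using hzi)
        rw [hz] at h1
        have hzI : z ∈ A.sellers := by
          rcases h1 with h1 | h1
          · exact absurd h1.1 (notMem_sellers hj)
          · exact mem_sellers_of_adj h1.2.1 hj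
        rw [if_neg (by simpa using hzi), Finset.sum_eq_single_of_mem z hzI, if_pos rfl]
        · simp [residualCost, notMem_sellers hj, Sym2.eq_swap]
        · intro b _ hb
          exact if_neg fun h => hb (Option.some.inj h).symm
  rw [Fintype.sum_option, A.sum_eq_sellers_add_buyers, Finset.sum_congr rfl hI,
    Finset.sum_congr rfl hJ, Finset.sum_comm (s := A.buyers), weight, weight,
    ← Finset.sum_sub_distrib, ← Finset.sum_add_distrib]
  have h0 : (if π none = none then 0 else A.residualCost none (π none)) = 0 := by
    simp [residualCost]
  rw [h0, zero_add]
  refine Finset.sum_congr rfl fun i hi => ?_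
  rw [← Finset.sum_sub_distrib, ← Finset.sum_add_distrib]
  refine Finset.sum_congr rfl fun j hj => ?_
  have hij : i ≠ j := by
    rintro rfl
    exact notMem_buyers hi hj
  by_cases h : M.Adj i j
  · have h1 : π (some j) ≠ some i := fun h' => not_adj_of_perm_buyer hπ hj hij h' h.symm
    by_cases h2 : π (some i) = some j <;> simp [exchange, h, h1, h2, hM.1 h]
  · have h1 : π (some i) ≠ some j := fun h' => h (adj_of_perm_seller hπ hi hij.symm h')
    by_cases h2 : π (some j) = some i
    · have h3 := hπ (some j) (by rw [h2]; simpa using hij)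
      rw [h2] at h3
      have h4 : A.G.Adj i j := by
        rcases h3 with h3 | h3
        · exact (hM.1 h3.2).symm
        · exact h3.2.1.symm
      simp [exchange, h, h1, h2, h4]
    · simp [exchange, h, h1, h2]

end Exchange

/-- Maximality of `M` says that no permutation of the residual network has negative cost. The price
of a seller is its potential relative to the root: root arcs give nonnegativity and price zero for
unsaturated sellers, and paths of two arcs through a buyer give the remaining inequalities. -/
theorem exists_isPricing (A : MPA V) : ∃ M u, A.IsPricing M u := by
  classical
  have hbot : A.IsBMatching (⊥ : SimpleGraph V) := ⟨bot_le, fun i => by simp [partners]⟩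
  obtain ⟨M, hM, hmax⟩ := Set.exists_max_image {M | A.IsBMatching M} A.weight
    (Set.toFinite _) ⟨⊥, hbot⟩
  obtain ⟨x, hx⟩ := exists_potential_of_rel A.residualCost (A.Residual M) (by
    intro π hπ
    rw [weight_sub_weight_exchange hM hπ, sub_nonneg]
    exact hmax _ (isBMatching_exchange hM hπ))
  have hI : ∀ i ∈ A.sellers, x none ≤ x (some i) := fun i hi => by
    simpa [residualCost] using hx none (some i) (by simp) (Or.inl hi)
  have hJ : ∀ j ∈ A.buyers, x (some j) ≤ x none := fun j hj => by
    simpa [residualCost] using hx (some j) none (by simp) (Or.inl hj)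
  have hMem : ∀ i ∈ A.sellers, ∀ j, M.Adj i j → x (some i) ≤ x (some j) + A.w s(i, j) :=
    fun i hi j h => by
      simpa [residualCost, hi] using
        hx (some i) (some j) (by simpa using h.ne) (Or.inl ⟨hi, h⟩)
  have hNot : ∀ i ∈ A.sellers, ∀ j, A.G.Adj i j → ¬ M.Adj i j →
      x (some j) ≤ x (some i) - A.w s(i, j) := fun i hi j h h' => by
    have hj := mem_buyers_of_adj h hi
    have := hx (some j) (some i) (by simpa using h.ne')
      (Or.inr ⟨hj, h.symm, fun h'' => h' h''.symm⟩)
    simpa [residualCost, notMem_sellers hj, Sym2.eq_swap, sub_eq_add_neg] using this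
  refine ⟨M, fun i => x (some i) - x none, hM, ?_, ?_, ?_, ?_, ?_⟩
  · intro i hi
    have := hI i hi
    linarith
  · intro i hi h
    have h1 := hI i hi
    have h2 : x (some i) ≤ x none + 0 := hx (some i) none (by simp) (Or.inr ⟨hi, h⟩)
    linarith
  · intro i hi j h
    have h1 := hMem i hi j h
    have h2 := hJ j (mem_buyers_of_adj (hM.1 h) hi)
    linarith
  · intro i hi k hk j h1 h2 h3 _
    have h4 := hMem i hi j h1
    have h5 := hNot k hk j h2 h3
    linarith
  · intro k hk j h2 h3 _ h4
    have h5 := hNot k hk j h2 h3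
    have h6 : x none ≤ x (some j) + 0 :=
      hx none (some j) (by simp) (Or.inr ⟨mem_buyers_of_adj h2 hk, h4⟩)
    linarith

end MPA

/-! ### Utilities, and stability of uniform prices. -/

namespace MatchingGame

variable {V : Type*} [Fintype V] {A : MatchingGame V} {M : SimpleGraph V} {p : V → V → ℝ}

theorem utility_of_lt {i : V} (h : (partners M i).card < A.b i) : A.utility M p i = 0 :=
  if_pos h

theorem utility_of_le {i : V} (h : A.b i ≤ (partners M i).card) :
    A.utility M p i = (partners M i).inf fun j => ((p i j : ℝ) : WithTop ℝ) :=
  if_neg h.not_gt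

theorem utility_le (h0 : ∀ i j, 0 ≤ p i j) {i j : V} (h : M.Adj i j) :
    A.utility M p i ≤ (p i j : WithTop ℝ) := by
  rcases lt_or_ge (partners M i).card (A.b i) with h1 | h1
  · rw [utility_of_lt h1]
    exact_mod_cast h0 i j
  · rw [utility_of_le h1]
    exact Finset.inf_le (mem_partners.mpr h)

theorem untopD_utility_le (h0 : ∀ i j, 0 ≤ p i j) {i j : V} (h : M.Adj i j) :
    (A.utility M p i).untopD 0 ≤ p i j := by
  have h1 := utility_le (A := A) h0 h
  obtain ⟨c, hc⟩ := WithTop.ne_top_iff_exists.mp (h1.trans_lt (WithTop.coe_lt_top _)).ne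
  rw [← hc] at h1 ⊢
  exact_mod_cast h1

theorem utility_nonneg (h0 : ∀ i j, 0 ≤ p i j) (i : V) : 0 ≤ A.utility M p i := by
  rcases lt_or_ge (partners M i).card (A.b i) with h1 | h1
  · rw [utility_of_lt h1]
  · rw [utility_of_le h1]
    refine Finset.le_inf fun j _ => ?_
    exact_mod_cast h0 i j

theorem le_utility {c : WithTop ℝ} {i : V} (h0 : (partners M i).card < A.b i → c ≤ 0)
    (h1 : A.b i ≤ (partners M i).card → ∀ j, M.Adj i j → c ≤ (p i j : WithTop ℝ)) :
    c ≤ A.utility M p i := by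
  rcases lt_or_ge (partners M i).card (A.b i) with h | h
  · rw [utility_of_lt h]
    exact h0 h
  · rw [utility_of_le h]
    exact Finset.le_inf fun j hj => h1 h j (mem_partners.mp hj)

theorem utility_ne_top (h0 : ∀ i j, 0 ≤ p i j) {i : V} (hb : 0 < A.b i) :
    A.utility M p i ≠ ⊤ := by
  rcases lt_or_ge (partners M i).card (A.b i) with h | h
  · rw [utility_of_lt h]
    exact WithTop.zero_ne_top
  · obtain ⟨j, hj⟩ := Finset.card_pos.mp (hb.trans_le h)
    exact ((utility_le h0 (mem_partners.mp hj)).trans_lt (WithTop.coe_lt_top _)).ne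

theorem utility_eq_top {i : V} (hM : (partners M i).card ≤ A.b i) (hb : A.b i = 0) :
    A.utility M p i = ⊤ := by
  have h0 : partners M i = ∅ := Finset.card_eq_zero.mp (by omega)
  rw [utility_of_le (by omega), h0, Finset.inf_empty]

end MatchingGame

namespace MPA

section PricePayoff

variable {V : Type*}

open Classical in
/-- The payoffs if every partner of the seller `i` under `M` pays the price `u i`. -/
noncomputable def pricePayoff (A : MPA V) (M : SimpleGraph V) (u : V → ℝ) (a b : V) : ℝ :=
  if M.Adj a b then if a ∈ A.sellers then u a else A.w s(a, b) - u b else 0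

variable {A : MPA V} {M : SimpleGraph V} {u : V → ℝ}

theorem pricePayoff_seller {i j : V} (hi : i ∈ A.sellers) (h : M.Adj i j) :
    A.pricePayoff M u i j = u i := by
  simp [pricePayoff, hi, h]

theorem pricePayoff_buyer {i j : V} (hj : j ∈ A.buyers) (h : M.Adj j i) :
    A.pricePayoff M u j i = A.w s(i, j) - u i := by
  simp [pricePayoff, notMem_sellers hj, h, Sym2.eq_swap]

theorem pricePayoff_of_not_adj {i j : V} (h : ¬ M.Adj i j) : A.pricePayoff M u i j = 0 := by
  simp [pricePayoff, h]

end PricePayoff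

namespace IsPricing

variable {V : Type*} [Fintype V] {A : MPA V} {M M' : SimpleGraph V} {u : V → ℝ}

theorem mem_buyers (h : A.IsPricing M u) {i j : V} (hi : i ∈ A.sellers) (hij : M.Adj i j) :
    j ∈ A.buyers :=
  mem_buyers_of_adj (h.isBMatching.1 hij) hi

theorem mem_sellers (h : A.IsPricing M u) {i j : V} (hi : i ∈ A.buyers) (hij : M.Adj i j) :
    j ∈ A.sellers :=
  mem_sellers_of_adj (h.isBMatching.1 hij) hi

theorem isSolution (h : A.IsPricing M u) : A.IsSolution M (A.pricePayoff M u) where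
  isBMatching := h.isBMatching
  nonneg i j := by
    by_cases hij : M.Adj i j
    · rcases A.cover i with hi | hi
      · rw [pricePayoff_seller hi hij]
        exact h.nonneg i hi
      · rw [pricePayoff_buyer hi hij]
        linarith [h.le_weight j (h.mem_sellers hi hij) i hij.symm]
    · rw [pricePayoff_of_not_adj hij]
  add_eq i j hij := by
    rcases A.cover i with hi | hi
    · rw [pricePayoff_seller hi hij, pricePayoff_buyer (h.mem_buyers hi hij) hij.symm]
      ring
    · rw [pricePayoff_buyer hi hij, pricePayoff_seller (h.mem_sellers hi hij) hij.symm,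
        Sym2.eq_swap]
      ring
  eq_zero i j hij := pricePayoff_of_not_adj hij

theorem utility_seller (h : A.IsPricing M u) {i : V} (hi : i ∈ A.sellers) (hb : 0 < A.b i) :
    A.utility M (A.pricePayoff M u) i = (u i : WithTop ℝ) := by
  rcases lt_or_ge (partners M i).card (A.b i) with h1 | h1
  · rw [utility_of_lt h1, h.unsaturated i hi h1, WithTop.coe_zero]
  · obtain ⟨j, hj⟩ := Finset.card_pos.mp (hb.trans_le h1)
    rw [mem_partners] at hj
    refine le_antisymm ?_ (le_utility (fun h2 => absurd h2 h1.not_gt) fun _ k hk => ?_)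
    · rw [← pricePayoff_seller (A := A) (u := u) hi hj]
      exact utility_le h.isSolution.nonneg hj
    · rw [pricePayoff_seller hi hk]

theorem not_blocking (h : A.IsPricing M u) {i j : V} (hi : i ∈ A.sellers) (hG : A.G.Adj i j)
    (hM : ¬ M.Adj i j) : ((A.w s(i, j) : ℝ) : WithTop ℝ) ≤
      A.utility M (A.pricePayoff M u) i + A.utility M (A.pricePayoff M u) j := by
  have hj := mem_buyers_of_adj hG hi
  rcases Nat.eq_zero_or_pos (A.b i) with hb | hb
  · rw [utility_eq_top (h.isBMatching.2 i) hb, top_add]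
    exact le_top
  · rw [h.utility_seller hi hb]
    have key : ((A.w s(i, j) - u i : ℝ) : WithTop ℝ) ≤ A.utility M (A.pricePayoff M u) j := by
      refine le_utility (fun h1 => ?_) fun _ k hk => ?_
      · have := h.add i hi j hG hM hb h1
        exact_mod_cast (by linarith : A.w s(i, j) - u i ≤ 0)
      · rw [pricePayoff_buyer hj hk]
        have := h.swap k (h.mem_sellers hj hk) i hi j hk.symm hG hM hb
        exact_mod_cast (by linarith : A.w s(i, j) - u i ≤ A.w s(k, j) - u k)
    calc ((A.w s(i, j) : ℝ) : WithTop ℝ) = (u i : WithTop ℝ) + ((A.w s(i, j) - u i : ℝ)) := by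
          rw [← WithTop.coe_add]
          congr 1
          ring
      _ ≤ _ := by gcongr

/-- Uniform prices without improvements for the buyers make a stable solution. -/
theorem isStable (h : A.IsPricing M u) : A.IsStable M (A.pricePayoff M u) where
  isSolution := h.isSolution
  not_blocking i j hG hM := by
    rcases A.cover i with hi | hi
    · exact h.not_blocking hi hG hM
    · rw [Sym2.eq_swap, add_comm]
      exact h.not_blocking (mem_sellers_of_adj hG hi) hG.symm fun h' => hM h'.symm

theorem pos_of_adj (h : A.IsPricing M u) {i j : V} (hij : M.Adj i j) : 0 < A.b i :=
  (Finset.card_pos.mpr ⟨j, mem_partners.mpr hij⟩).trans_le (h.isBMatching.2 i)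

/-- The seller `x`, a partner of `j` only under `M`, still offers its good to `j` at the same price.
So under `M'` the buyer has nothing worse than what `x` would yield. -/
theorem sub_le_utility (h' : A.IsPricing M' u) (h : A.IsPricing M u) {x j : V}
    (hj : j ∈ A.buyers) (hx : M.Adj x j) (hx' : ¬ M'.Adj x j) :
    ((A.w s(x, j) - u x : ℝ) : WithTop ℝ) ≤ A.utility M' (A.pricePayoff M' u) j := by
  have hxI := h.mem_sellers hj hx.symm
  have hG := h.isBMatching.1 hx
  refine le_utility (fun h1 => ?_) fun _ k hk => ?_
  · have := h'.add x hxI j hG hx' (h.pos_of_adj hx) h1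
    exact_mod_cast (by linarith : A.w s(x, j) - u x ≤ 0)
  · rw [pricePayoff_buyer hj hk]
    have := h'.swap k (h'.mem_sellers hj hk) x hxI j hk.symm hG hx' (h.pos_of_adj hx)
    exact_mod_cast (by linarith : A.w s(x, j) - u x ≤ A.w s(k, j) - u k)

/-- If some partner under `M` is dropped in `M'`, then `sub_le_utility` applies. Otherwise the
partners only grow, and saturation under `M` forces the two sets to coincide. -/
theorem utility_buyer_le (h : A.IsPricing M u) (h' : A.IsPricing M' u) {j : V}
    (hj : j ∈ A.buyers) :
    A.utility M (A.pricePayoff M u) j ≤ A.utility M' (A.pricePayoff M' u) j := by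
  have hcase : (∃ x, M.Adj j x ∧ ¬ M'.Adj j x) ∨ partners M j ⊆ partners M' j := by
    by_cases hsub : partners M j ⊆ partners M' j
    · exact Or.inr hsub
    · obtain ⟨x, h1, h2⟩ := Finset.not_subset.mp hsub
      exact Or.inl ⟨x, mem_partners.mp h1, fun h3 => h2 (mem_partners.mpr h3)⟩
  rcases hcase with ⟨x, hx, hx'⟩ | hsub
  · refine (utility_le h.isSolution.nonneg hx).trans ?_
    rw [pricePayoff_buyer hj hx]
    exact h'.sub_le_utility h hj hx.symm fun h3 => hx' h3.symm
  · refine le_utility (fun h1 => ?_) fun h1 k hk => ?_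
    · rw [utility_of_lt ((Finset.card_le_card hsub).trans_lt h1)]
    · rcases lt_or_ge (partners M j).card (A.b j) with h2 | h2
      · rw [utility_of_lt h2]
        exact_mod_cast h'.isSolution.nonneg j k
      · have heq := Finset.eq_of_subset_of_card_le hsub ((h'.isBMatching.2 j).trans h2)
        have hkM : M.Adj j k := mem_partners.mp (heq ▸ mem_partners.mpr hk)
        refine (utility_le h.isSolution.nonneg hkM).trans_eq ?_
        rw [pricePayoff_buyer hj hk, pricePayoff_buyer hj hkM]

theorem utility_eq (h : A.IsPricing M u) (h' : A.IsPricing M' u) (i : V) :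
    A.utility M (A.pricePayoff M u) i = A.utility M' (A.pricePayoff M' u) i := by
  rcases A.cover i with hi | hi
  · rcases Nat.eq_zero_or_pos (A.b i) with hb | hb
    · rw [utility_eq_top (h.isBMatching.2 i) hb, utility_eq_top (h'.isBMatching.2 i) hb]
    · rw [h.utility_seller hi hb, h'.utility_seller hi hb]
  · exact le_antisymm (h.utility_buyer_le h' hi) (h'.utility_buyer_le h hi)

theorem coe_eq_utility (h : A.IsPricing M u) (h' : A.IsPricing M' u) {i j : V}
    (hM : M.Adj i j) (hM' : ¬ M'.Adj i j) :
    ((A.pricePayoff M u i j : ℝ) : WithTop ℝ) = A.utility M (A.pricePayoff M u) i := by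
  rcases A.cover i with hi | hi
  · rw [pricePayoff_seller hi hM, h.utility_seller hi (h.pos_of_adj hM)]
  · refine le_antisymm ?_ (utility_le h.isSolution.nonneg hM)
    rw [h.utility_eq h', pricePayoff_buyer hi hM]
    exact h'.sub_le_utility h hi hM.symm fun h3 => hM' h3.symm

/-- Two matchings supported by the same prices give equivalent payoffs. -/
theorem equivalent (h : A.IsPricing M u) (h' : A.IsPricing M' u) :
    A.Equivalent M (A.pricePayoff M u) M' (A.pricePayoff M' u) where
  utility_eq := h.utility_eq h'
  both i j hM hM' := by
    rcases A.cover i with hi | hi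
    · rw [pricePayoff_seller hi hM, pricePayoff_seller hi hM']
    · rw [pricePayoff_buyer hi hM, pricePayoff_buyer hi hM']
  left i j hM hM' := h.coe_eq_utility h' hM hM'
  right i j hM' hM := h'.coe_eq_utility h hM' hM

theorem totalPayoff_eq_sum (h : A.IsPricing M u) (i : V) :
    A.totalPayoff (A.pricePayoff M u) i = ∑ j ∈ partners M i, A.pricePayoff M u i j := by
  classical
  refine (Finset.sum_subset (fun j hj => ?_) fun j _ hj => ?_).symm
  · exact Finset.mem_filter.mpr ⟨Finset.mem_univ j, h.isBMatching.1 (mem_partners.mp hj)⟩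
  · exact pricePayoff_of_not_adj fun h' => hj (mem_partners.mpr h')

/-- Counting unsold copies is harmless: an unsaturated seller has price zero. -/
theorem totalPayoff_seller (h : A.IsPricing M u) {i : V} (hi : i ∈ A.sellers) :
    A.totalPayoff (A.pricePayoff M u) i = A.b i * u i := by
  rw [h.totalPayoff_eq_sum, Finset.sum_congr rfl fun j hj =>
    pricePayoff_seller hi (mem_partners.mp hj), Finset.sum_const, nsmul_eq_mul]
  rcases lt_or_ge (partners M i).card (A.b i) with h1 | h1
  · rw [h.unsaturated i hi h1, mul_zero, mul_zero]
  · rw [le_antisymm (h.isBMatching.2 i) h1]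

end IsPricing

end MPA

/-! ### Demand sets and changes of single items. -/

namespace MPA

section Demand

variable {V : Type*} {A : MPA V} {j : {j // j ∈ A.buyers}} {T T' : Finset A.Item}

theorem IsBundle.mono (h : A.IsBundle j T) (hT : T' ⊆ T) : A.IsBundle j T' where
  adj x hx := h.adj x (hT hx)
  one_per_seller x hx y hy := h.one_per_seller x (hT hx) y (hT hy)
  card_le := (Finset.card_le_card hT).trans h.card_le

theorem IsBundle.insert [DecidableEq A.Item] (h : A.IsBundle j T) {y : A.Item}
    (hy : A.G.Adj y.1 j) (hT : ∀ z ∈ T, z.1 ≠ y.1) (hb : T.card < A.b j) :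
    A.IsBundle j (insert y T) where
  adj x hx := by
    rcases Finset.mem_insert.mp hx with rfl | hx
    · exact hy
    · exact h.adj x hx
  one_per_seller x hx z hz hxz := by
    rcases Finset.mem_insert.mp hx with rfl | hx' <;>
      rcases Finset.mem_insert.mp hz with rfl | hz'
    · rfl
    · exact absurd hxz.symm (hT z hz')
    · exact absurd hxz (hT x hx')
    · exact h.one_per_seller x hx' z hz' hxz
  card_le := (Finset.card_insert_le y T).trans hb

/-- If the bundle `T` cannot be improved by dropping, exchanging or adding one item, then no
bundle is better than `T`. -/
theorem bundlePayoff_le {q : A.Item → ℝ} (hT : A.IsBundle j T)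
    (hdrop : ∀ x ∈ T, q x ≤ A.w s((x.1 : V), (j : V)))
    (hswap : ∀ x ∈ T, ∀ y : A.Item, A.G.Adj y.1 j → (∀ z ∈ T, z.1 = y.1 → z = x) →
      q x + A.w s((y.1 : V), (j : V)) ≤ q y + A.w s((x.1 : V), (j : V)))
    (hadd : T.card < A.b j → ∀ y : A.Item, A.G.Adj y.1 j → (∀ z ∈ T, z.1 ≠ y.1) →
      A.w s((y.1 : V), (j : V)) ≤ q y) (hT' : A.IsBundle j T') :
    A.bundlePayoff q j T' ≤ A.bundlePayoff q j T := by
  classical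
  set v : A.Item → ℝ := fun x => A.w s((x.1 : V), (j : V)) - q x with hv
  change ∑ x ∈ T', v x ≤ ∑ x ∈ T, v x
  rcases Nat.eq_zero_or_pos (A.b j) with hb | hb
  · have h1 : T = ∅ := Finset.card_eq_zero.mp (by have := hT.card_le; omega)
    have h2 : T' = ∅ := Finset.card_eq_zero.mp (by have := hT'.card_le; omega)
    rw [h1, h2]
  -- `t` is the dual value of the buyer's capacity: zero if a place is free, and otherwise the least
  -- gain of an item of `T`.
  obtain ⟨t, ht0, ht1, ht2, ht3⟩ : ∃ t : ℝ, 0 ≤ t ∧ (∀ x ∈ T, t ≤ v x) ∧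
      (∀ y : A.Item, A.G.Adj y.1 j → (∀ z ∈ T, z.1 ≠ y.1) → v y ≤ t) ∧
      (A.b j : ℝ) * t = T.card * t := by
    rcases lt_or_ge T.card (A.b j) with h1 | h1
    · refine ⟨0, le_rfl, fun x hx => sub_nonneg.mpr (hdrop x hx), fun y hy hz => ?_, by simp⟩
      exact sub_nonpos.mpr (hadd h1 y hy hz)
    · obtain ⟨x, hx, hmin⟩ := Finset.exists_min_image T v (Finset.card_pos.mp (hb.trans_le h1))
      refine ⟨v x, sub_nonneg.mpr (hdrop x hx), hmin, fun y hy hz => ?_, ?_⟩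
      · have := hswap x hx y hy fun z hzT h => absurd h (hz z hzT)
        simp only [hv]
        linarith
      · rw [le_antisymm hT.card_le h1]
  -- The excess over `t` of an item of `T'` is charged to the item of `T` of the same seller, if
  -- there is one. As `T'` has one item per seller, every item of `T` is charged at most once.
  have h1 : ∀ y ∈ T', v y - t ≤ ∑ x ∈ T, if x.1 = y.1 then v x - t else 0 := by
    intro y hy
    have hpos : ∀ x ∈ T, 0 ≤ if x.1 = y.1 then v x - t else 0 := fun x hx => by
      split_ifs
      · exact sub_nonneg.mpr (ht1 x hx)
      · exact le_rfl
    by_cases hz : ∃ x ∈ T, x.1 = y.1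
    · obtain ⟨x, hx, hxy⟩ := hz
      refine le_trans ?_ (Finset.single_le_sum hpos hx)
      rw [if_pos hxy]
      have := hswap x hx y (hT'.adj y hy) fun z hz h =>
        hT.one_per_seller z hz x hx (h.trans hxy.symm)
      simp only [hv]
      linarith
    · push Not at hz
      exact (sub_nonpos.mpr (ht2 y (hT'.adj y hy) hz)).trans (Finset.sum_nonneg hpos)
  have h2 : ∀ x ∈ T, (∑ y ∈ T', if x.1 = y.1 then v x - t else 0) ≤ v x - t := by
    intro x hx
    rw [← Finset.sum_filter, Finset.sum_const, nsmul_eq_mul]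
    have hcard : (T'.filter fun y => x.1 = y.1).card ≤ 1 := by
      rw [Finset.card_le_one]
      intro y hy z hz
      rw [Finset.mem_filter] at hy hz
      exact hT'.one_per_seller y hy.1 z hz.1 (hy.2.symm.trans hz.2)
    exact mul_le_of_le_one_left (sub_nonneg.mpr (ht1 x hx)) (by exact_mod_cast hcard)
  have h3 := Finset.sum_le_sum h1
  rw [Finset.sum_comm] at h3
  have h4 := h3.trans (Finset.sum_le_sum h2)
  simp only [Finset.sum_sub_distrib, Finset.sum_const, nsmul_eq_mul] at h4
  have h5 : (T'.card : ℝ) * t ≤ A.b j * t :=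
    mul_le_mul_of_nonneg_right (by exact_mod_cast hT'.card_le) ht0
  linarith

/-- The demand set is described by inequalities between the prices of at most two items. -/
theorem mem_demand_iff {q : A.Item → ℝ} :
    T ∈ A.demand q j ↔ A.IsBundle j T ∧
      (∀ x ∈ T, q x ≤ A.w s((x.1 : V), (j : V))) ∧
      (∀ x ∈ T, ∀ y : A.Item, A.G.Adj y.1 j → (∀ z ∈ T, z.1 = y.1 → z = x) →
        q x + A.w s((y.1 : V), (j : V)) ≤ q y + A.w s((x.1 : V), (j : V))) ∧
      (T.card < A.b j → ∀ y : A.Item, A.G.Adj y.1 j → (∀ z ∈ T, z.1 ≠ y.1) →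
        A.w s((y.1 : V), (j : V)) ≤ q y) := by
  classical
  refine ⟨fun ⟨hT, hmax⟩ => ⟨hT, ?_, ?_, ?_⟩,
    fun ⟨hT, h1, h2, h3⟩ => ⟨hT, fun T' hT' => bundlePayoff_le hT h1 h2 h3 hT'⟩⟩
  · intro x hx
    have h1 := hmax _ (hT.mono (Finset.erase_subset x T))
    rw [bundlePayoff, bundlePayoff, ← Finset.add_sum_erase T _ hx] at h1
    linarith
  · intro x hx y hy hz
    by_cases hyT : y ∈ T
    · rw [hz y hyT rfl]
    · have hb : (T.erase x).card < A.b j :=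
        (Finset.card_erase_lt_of_mem hx).trans_le hT.card_le
      have h1 := hmax _ ((hT.mono (Finset.erase_subset x T)).insert hy (fun z hz' h =>
        (Finset.mem_erase.mp hz').1 (hz z (Finset.mem_of_mem_erase hz') h)) hb)
      rw [bundlePayoff, bundlePayoff, ← Finset.add_sum_erase T _ hx,
        Finset.sum_insert fun h => hyT (Finset.mem_of_mem_erase h)] at h1
      linarith
  · intro hb y hy hz
    have h1 := hmax _ (hT.insert hy hz hb)
    rw [bundlePayoff, bundlePayoff, Finset.sum_insert fun h => hz y h rfl] at h1
    linarith

end Demand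

/-! ### Allocations of items as `b`-matchings. -/

section Matching

variable {V : Type*} {A : MPA V} {B : {j // j ∈ A.buyers} → Finset A.Item}

theorem matching_adj {i j : V} (hi : i ∈ A.sellers) (hj : j ∈ A.buyers) :
    (A.matching B).Adj i j ↔ ∃ x ∈ B ⟨j, hj⟩, (x.1 : V) = i := by
  rw [matching, SimpleGraph.fromRel_adj]
  constructor
  · rintro ⟨-, ⟨k, x, hx, rfl, rfl⟩ | ⟨k, x, hx, rfl, rfl⟩⟩
    · exact ⟨x, hx, rfl⟩
    · exact absurd k.2 (notMem_buyers hi)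
  · rintro ⟨x, hx, rfl⟩
    exact ⟨fun h => notMem_buyers hi (h ▸ hj), Or.inl ⟨⟨j, hj⟩, x, hx, rfl, rfl⟩⟩

theorem matching_adj_of_mem {j : {j // j ∈ A.buyers}} {x : A.Item} (hx : x ∈ B j) :
    (A.matching B).Adj x.1 j :=
  (matching_adj x.1.2 j.2).mpr ⟨x, hx, rfl⟩

theorem exists_of_matching_adj {a b : V} (h : (A.matching B).Adj a b) :
    (a ∈ A.sellers ∧ b ∈ A.buyers) ∨ (b ∈ A.sellers ∧ a ∈ A.buyers) := by
  rw [matching, SimpleGraph.fromRel_adj] at h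
  rcases h with ⟨-, ⟨k, x, -, rfl, rfl⟩ | ⟨k, x, -, rfl, rfl⟩⟩
  · exact Or.inl ⟨x.1.2, k.2⟩
  · exact Or.inr ⟨x.1.2, k.2⟩

theorem matching_le (hB : ∀ j, A.IsBundle j (B j)) : A.matching B ≤ A.G := by
  intro a b h
  rcases exists_of_matching_adj h with ⟨ha, hb⟩ | ⟨hb, ha⟩
  · obtain ⟨x, hx, rfl⟩ := (matching_adj ha hb).mp h
    exact (hB _).adj x hx
  · obtain ⟨x, hx, rfl⟩ := (matching_adj hb ha).mp h.symm
    exact ((hB _).adj x hx).symm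

variable [Fintype V]

theorem partners_matching [DecidableEq V] (j : {j // j ∈ A.buyers}) :
    partners (A.matching B) j = (B j).image fun x => (x.1 : V) := by
  ext i
  rw [mem_partners, Finset.mem_image]
  constructor
  · intro h
    have hi : i ∈ A.sellers := by
      rcases exists_of_matching_adj h with h' | h'
      · exact absurd j.2 (notMem_buyers h'.1)
      · exact h'.1
    exact (matching_adj hi j.2).mp h.symm
  · rintro ⟨x, hx, rfl⟩
    exact (matching_adj_of_mem hx).symm

theorem card_partners_matching {j : {j // j ∈ A.buyers}}
    (hB : ∀ x ∈ B j, ∀ y ∈ B j, x.1 = y.1 → x = y) :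
    (partners (A.matching B) j).card = (B j).card := by
  classical
  rw [partners_matching, Finset.card_image_of_injOn]
  exact fun x hx y hy h => hB x hx y hy (Subtype.ext h)

/-- By disjointness different buyers hold different copies. -/
theorem card_partners_matching_seller_le {i : V} (hi : i ∈ A.sellers)
    (hB : ∀ j k, j ≠ k → Disjoint (B j) (B k)) :
    (partners (A.matching B) i).card ≤ A.b i := by
  classical
  have hbuy : ∀ j ∈ partners (A.matching B) i, j ∈ A.buyers := fun j hj => by
    rcases exists_of_matching_adj (mem_partners.mp hj) with h' | h'
    · exact h'.2
    · exact absurd h'.2 (notMem_buyers hi)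
  have hex : ∀ j : {j // j ∈ partners (A.matching B) i}, ∃ s : Fin (A.b i),
      (⟨⟨i, hi⟩, s⟩ : A.Item) ∈ B ⟨j, hbuy j j.2⟩ := by
    rintro ⟨j, hj⟩
    obtain ⟨⟨⟨i', hi'⟩, s⟩, hx, rfl⟩ := (matching_adj hi (hbuy j hj)).mp (mem_partners.mp hj)
    exact ⟨s, hx⟩
  choose f hf using hex
  have hinj : Function.Injective f := by
    intro j k hjk
    by_contra hne
    have h1 := hf j
    rw [hjk] at h1
    refine Finset.disjoint_left.mp (hB _ _ fun h => hne (Subtype.ext ?_)) h1 (hf k)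
    exact congrArg (fun k : {j // j ∈ A.buyers} => (k : V)) h
  simpa using Fintype.card_le_of_injective f hinj

/-- If all copies were sold, their owners would be distinct, as a bundle has one copy per seller. -/
theorem exists_unsold {i : V} (hi : i ∈ A.sellers) (hB : ∀ j, A.IsBundle j (B j))
    (h : (partners (A.matching B) i).card < A.b i) :
    ∃ s : Fin (A.b i), ∀ j, (⟨⟨i, hi⟩, s⟩ : A.Item) ∉ B j := by
  by_contra hcon
  push Not at hcon
  choose g hg using hcon
  have h1 := Finset.card_le_card_of_injOn (s := Finset.univ) (t := partners (A.matching B) i)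
    (fun s => (g s : V)) (fun s _ => by
      simpa [mem_partners] using matching_adj_of_mem (hg s)) (fun s _ t _ hst => by
      have h2 := hg s
      rw [Subtype.ext hst] at h2
      have h3 := (hB _).one_per_seller _ h2 _ (hg t) rfl
      simpa using h3)
  simp at h1
  omega

end Matching

end MPA

/-! ### Passing between equilibria, uniform prices and stable solutions. -/

namespace MPA

open Classical in
/-- The price of the first item of a seller, and zero for all other players. -/
noncomputable def sellerPrice {V : Type*} (A : MPA V) (q : A.Item → ℝ) (i : V) : ℝ :=
  if h : i ∈ A.sellers ∧ 0 < A.b i then q ⟨⟨i, h.1⟩, ⟨0, h.2⟩⟩ else 0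

namespace IsCompetitiveEquilibrium

section Prices

variable {V : Type*} {A : MPA V} {B : {j // j ∈ A.buyers} → Finset A.Item} {q : A.Item → ℝ}

theorem isBundle (h : A.IsCompetitiveEquilibrium B q) (j : {j // j ∈ A.buyers}) :
    A.IsBundle j (B j) :=
  (h.mem_demand j).1

/-- The owner of `x` could take the copy `y` instead, and an unsold item has price zero. -/
theorem price_le_of_seller_eq (h : A.IsCompetitiveEquilibrium B q) {x y : A.Item}
    (hxy : x.1 = y.1) : q x ≤ q y := by
  by_cases hx : ∃ j, x ∈ B j
  · obtain ⟨j, hx⟩ := hx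
    have hadj := (h.isBundle j).adj x hx
    have := (mem_demand_iff.mp (h.mem_demand j)).2.2.1 x hx y (hxy ▸ hadj)
      fun z hz hzy => (h.isBundle j).one_per_seller z hz x hx (hzy.trans hxy.symm)
    rw [hxy] at this
    linarith
  · push Not at hx
    rw [h.unsold x hx]
    exact h.price_nonneg y

theorem price_eq (h : A.IsCompetitiveEquilibrium B q) (x : A.Item) :
    q x = A.sellerPrice q x.1 := by
  have hx : (x.1 : V) ∈ A.sellers ∧ 0 < A.b x.1 := ⟨x.1.2, Fin.pos x.2⟩
  rw [sellerPrice, dif_pos hx]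
  exact le_antisymm (h.price_le_of_seller_eq rfl) (h.price_le_of_seller_eq rfl)

theorem exists_mem_of_adj (h : A.IsCompetitiveEquilibrium B q) {i j : V} (hi : i ∈ A.sellers)
    (hij : (A.matching B).Adj i j) :
    ∃ hj : j ∈ A.buyers, ∃ x ∈ B ⟨j, hj⟩, (x.1 : V) = i := by
  have hj := mem_buyers_of_adj (matching_le h.isBundle hij) hi
  exact ⟨hj, (matching_adj hi hj).mp hij⟩

theorem payoff_eq (h : A.IsCompetitiveEquilibrium B q) :
    A.payoff B q = A.pricePayoff (A.matching B) (A.sellerPrice q) := by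
  classical
  funext a b
  by_cases hab : (A.matching B).Adj a b
  · rcases exists_of_matching_adj hab with ⟨ha, hb⟩ | ⟨hb, ha⟩
    · rw [pricePayoff_seller ha hab]
      obtain ⟨x, hx, rfl⟩ := (matching_adj ha hb).mp hab
      have hne : ∀ j : {j // j ∈ A.buyers}, (j : V) ≠ x.1 := fun j hj =>
        notMem_buyers ha (hj ▸ j.2)
      rw [payoff, Fintype.sum_eq_single ⟨b, hb⟩, Finset.sum_eq_single_of_mem x hx]
      · simp [h.price_eq x, fun h' : b = x.1 => hne ⟨b, hb⟩ h']
      · intro y hy hyx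
        have : (y.1 : V) ≠ x.1 := fun h' =>
          hyx ((h.isBundle _).one_per_seller y hy x hx (Subtype.ext h'))
        simp [this, fun h' : b = x.1 => hne ⟨b, hb⟩ h']
      · intro j hj
        have : (j : V) ≠ b := fun h' => hj (Subtype.ext h')
        simp [this, hne]
    · rw [pricePayoff_buyer ha hab]
      obtain ⟨x, hx, rfl⟩ := (matching_adj hb ha).mp hab.symm
      have hne : ∀ y : A.Item, (y.1 : V) ≠ a := fun y hy => notMem_buyers (hy ▸ y.1.2) ha
      rw [payoff, Fintype.sum_eq_single ⟨a, ha⟩, Finset.sum_eq_single_of_mem x hx]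
      · simp [hne, h.price_eq x, Sym2.eq_swap]
      · intro y hy hyx
        have : (y.1 : V) ≠ x.1 := fun h' =>
          hyx ((h.isBundle _).one_per_seller y hy x hx (Subtype.ext h'))
        simp [this, hne]
      · intro j hj
        have : (j : V) ≠ a := fun h' => hj (Subtype.ext h')
        simp [this, hne]
  · rw [pricePayoff_of_not_adj hab, payoff]
    refine Finset.sum_eq_zero fun j _ => Finset.sum_eq_zero fun x hx => ?_
    have hx' := matching_adj_of_mem hx
    rw [if_neg, if_neg, add_zero]
    · rintro ⟨rfl, rfl⟩
      exact hab hx'.symm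
    · rintro ⟨rfl, rfl⟩
      exact hab hx'

end Prices

variable {V : Type*} [Fintype V] {A : MPA V} {B : {j // j ∈ A.buyers} → Finset A.Item}
  {q : A.Item → ℝ}

theorem isPricing (h : A.IsCompetitiveEquilibrium B q) :
    A.IsPricing (A.matching B) (A.sellerPrice q) where
  isBMatching := by
    refine ⟨matching_le h.isBundle, fun i => ?_⟩
    rcases A.cover i with hi | hi
    · exact card_partners_matching_seller_le hi h.disjoint
    · exact (card_partners_matching (h.isBundle ⟨i, hi⟩).one_per_seller).trans_le
        (h.isBundle ⟨i, hi⟩).card_le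
  nonneg i hi := by
    rw [sellerPrice]
    split_ifs
    · exact h.price_nonneg _
    · exact le_rfl
  unsaturated i hi hlt := by
    obtain ⟨s, hs⟩ := exists_unsold hi h.isBundle hlt
    rw [← h.unsold _ hs, h.price_eq]
  le_weight i hi j hij := by
    obtain ⟨hj, x, hx, rfl⟩ := h.exists_mem_of_adj hi hij
    rw [← h.price_eq]
    exact (mem_demand_iff.mp (h.mem_demand _)).2.1 x hx
  swap i hi k hk j hij hkj hkj' hb := by
    obtain ⟨hj, x, hx, rfl⟩ := h.exists_mem_of_adj hi hij
    have := (mem_demand_iff.mp (h.mem_demand _)).2.2.1 x hx ⟨⟨k, hk⟩, ⟨0, hb⟩⟩ hkj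
      fun z hz hzk => absurd ((matching_adj hk hj).mpr ⟨z, hz, congrArg Subtype.val hzk⟩) hkj'
    rwa [h.price_eq, h.price_eq] at this
  add k hk j hkj hkj' hb hlt := by
    have hj := mem_buyers_of_adj hkj hk
    have hlt' : (B ⟨j, hj⟩).card < A.b j := by
      rw [← card_partners_matching (h.isBundle ⟨j, hj⟩).one_per_seller]
      exact hlt
    have := (mem_demand_iff.mp (h.mem_demand ⟨j, hj⟩)).2.2.2 hlt' ⟨⟨k, hk⟩, ⟨0, hb⟩⟩ hkj
      fun z hz hzk => hkj' ((matching_adj hk hj).mpr ⟨z, hz, congrArg Subtype.val hzk⟩)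
    rwa [h.price_eq] at this

theorem isStable (h : A.IsCompetitiveEquilibrium B q) :
    A.IsStable (A.matching B) (A.payoff B q) := by
  rw [h.payoff_eq]
  exact h.isPricing.isStable

theorem totalPayoff_seller (h : A.IsCompetitiveEquilibrium B q) {i : V} (hi : i ∈ A.sellers) :
    A.totalPayoff (A.payoff B q) i = A.b i * A.sellerPrice q i := by
  rw [h.payoff_eq, h.isPricing.totalPayoff_seller hi]

theorem totalPayoff_buyer (h : A.IsCompetitiveEquilibrium B q) (j : {j // j ∈ A.buyers}) :
    A.totalPayoff (A.payoff B q) j = A.bundlePayoff q j (B j) := by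
  classical
  rw [h.payoff_eq, h.isPricing.totalPayoff_eq_sum,
    Finset.sum_congr rfl fun i hi => pricePayoff_buyer j.2 (mem_partners.mp hi),
    partners_matching, Finset.sum_image, bundlePayoff]
  · exact Finset.sum_congr rfl fun x _ => by rw [h.price_eq x]
  · exact fun x hx y hy hxy => (h.isBundle j).one_per_seller x hx y hy (Subtype.ext hxy)

end IsCompetitiveEquilibrium

variable {V : Type*} [Fintype V] {A : MPA V} {M : SimpleGraph V} {u : V → ℝ}

theorem exists_injOn_lt {α : Type*} {s : Finset α} {n : ℕ} (h : s.card ≤ n) :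
    ∃ g : α → ℕ, Set.InjOn g s ∧ ∀ j ∈ s, g j < n := by
  classical
  refine ⟨fun j => if hj : j ∈ s then (s.equivFin ⟨j, hj⟩ : ℕ) else 0, ?_, ?_⟩
  · intro j hj k hk hjk
    have hj' : j ∈ s := hj
    have hk' : k ∈ s := hk
    simp only [hj', hk', dif_pos] at hjk
    simpa using s.equivFin.injective (Fin.ext hjk)
  · intro j hj
    simp only [hj, dif_pos]
    exact (Fin.is_lt _).trans_le h

/-- Uniform prices without improvements for the buyers are equilibrium prices. -/
theorem IsPricing.exists_isCompetitiveEquilibrium (h : A.IsPricing M u) :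
    ∃ B, A.IsCompetitiveEquilibrium B (fun x => u x.1) ∧ A.matching B = M := by
  classical
  -- `f i` numbers the partners of `i`: the partner `j` receives the copy `f i j`.
  choose f hinj hlt using fun i => exists_injOn_lt (h.isBMatching.2 i)
  set B : {j // j ∈ A.buyers} → Finset A.Item := fun j =>
    Finset.univ.filter fun x => M.Adj x.1 j ∧ f x.1 j = x.2 with hBdef
  have hB : ∀ j x, x ∈ B j ↔ M.Adj x.1 j ∧ f x.1 j = x.2 := fun j x => by simp [hBdef]
  have hadj : ∀ i (hi : i ∈ A.sellers) (j : {j // j ∈ A.buyers}), M.Adj i j →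
      ∃ x ∈ B j, x.1 = ⟨i, hi⟩ := fun i hi j hij =>
    ⟨⟨⟨i, hi⟩, ⟨f i j, hlt i j (mem_partners.mpr hij)⟩⟩, (hB _ _).mpr ⟨hij, rfl⟩, rfl⟩
  have hmatch : A.matching B = M := by
    ext a b
    have key : ∀ i ∈ A.sellers, ∀ j ∈ A.buyers, (A.matching B).Adj i j ↔ M.Adj i j := by
      intro i hi j hj
      rw [matching_adj hi hj]
      constructor
      · rintro ⟨x, hx, rfl⟩
        exact ((hB _ _).mp hx).1
      · intro hij
        obtain ⟨x, hx, hxi⟩ := hadj i hi ⟨j, hj⟩ hij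
        exact ⟨x, hx, congrArg Subtype.val hxi⟩
    rcases A.cover a with ha | ha <;> rcases A.cover b with hb | hb
    · refine iff_of_false (fun h' => ?_) fun h' => notMem_sellers (h.mem_buyers ha h') hb
      rcases exists_of_matching_adj h' with h' | h'
      · exact notMem_buyers hb h'.2
      · exact notMem_buyers ha h'.2
    · exact key a ha b hb
    · rw [SimpleGraph.adj_comm, M.adj_comm]
      exact key b hb a ha
    · refine iff_of_false (fun h' => ?_) fun h' => notMem_sellers hb (h.mem_sellers ha h')
      rcases exists_of_matching_adj h' with h' | h'
      · exact notMem_buyers h'.1 ha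
      · exact notMem_buyers h'.1 hb
  have hone : ∀ j, ∀ x ∈ B j, ∀ y ∈ B j, x.1 = y.1 → x = y := by
    rintro j ⟨i, s⟩ hx ⟨i', s'⟩ hy hxy
    obtain rfl : i = i' := hxy
    have h1 := ((hB _ _).mp hx).2.symm.trans ((hB _ _).mp hy).2
    exact congrArg (Sigma.mk i) (Fin.ext h1)
  have hcard : ∀ j, (B j).card = (partners M j).card := fun j => by
    rw [← card_partners_matching (hone j), hmatch]
  refine ⟨B, ⟨fun x => h.nonneg _ x.1.2, fun j => ?_, fun x hx => ?_, fun j k hjk => ?_⟩, hmatch⟩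
  · refine mem_demand_iff.mpr ⟨⟨fun x hx => h.isBMatching.1 ((hB _ _).mp hx).1, hone j,
      (hcard j).trans_le (h.isBMatching.2 j)⟩, fun x hx => ?_, fun x hx y hy hz => ?_,
      fun hb y hy hz => ?_⟩
    · exact h.le_weight _ x.1.2 _ ((hB _ _).mp hx).1
    -- If `j` already holds a copy from the seller of `y`, that copy is `x` by `hz`, and both sides
    -- agree.
    · by_cases hyM : M.Adj y.1 j
      · obtain ⟨z, hzB, hzy⟩ := hadj y.1 y.1.2 j hyM
        have hxy : x.1 = y.1 := (hz z hzB hzy) ▸ hzy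
        rw [hxy]
      · exact h.swap _ x.1.2 _ y.1.2 _ ((hB _ _).mp hx).1 hy hyM (Fin.pos y.2)
    · refine h.add _ y.1.2 _ hy (fun hyM => ?_) (Fin.pos y.2) ((hcard j).symm.trans_lt hb)
      obtain ⟨z, hzB, hzy⟩ := hadj y.1 y.1.2 j hyM
      exact hz z hzB hzy
  -- If the seller were saturated, the numbering would exhaust its copies and `x` would be sold.
  · refine h.unsaturated _ x.1.2 ((h.isBMatching.2 _).lt_of_ne fun hc => ?_)
    have himg : (partners M x.1).image (f x.1) = Finset.range (A.b x.1) := by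
      refine Finset.eq_of_subset_of_card_le (fun n hn => ?_) ?_
      · obtain ⟨j, hj, rfl⟩ := Finset.mem_image.mp hn
        exact Finset.mem_range.mpr (hlt _ _ hj)
      · rw [Finset.card_image_of_injOn (hinj _), Finset.card_range, hc]
    obtain ⟨j, hj, hjx⟩ := Finset.mem_image.mp
      (himg.symm ▸ Finset.mem_range.mpr x.2.2 : (x.2 : ℕ) ∈ _)
    rw [mem_partners] at hj
    exact hx ⟨j, h.mem_buyers x.1.2 hj⟩ ((hB _ _).mpr ⟨hj, hjx⟩)
  · refine Finset.disjoint_left.mpr fun x hx hx' => hjk (Subtype.ext ?_)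
    rw [hB] at hx hx'
    exact hinj _ (mem_partners.mpr hx.1) (mem_partners.mpr hx'.1) (hx.2.trans hx'.2.symm)

/-- The utilities of the sellers in a stable solution are equilibrium prices. -/
theorem isPricing_of_isStable {p : V → V → ℝ} (h : A.IsStable M p) :
    A.IsPricing M fun i => (A.utility M p i).untopD 0 := by
  have h0 := h.isSolution.nonneg
  -- The default value of `untopD` is taken only by players without capacity, whose utility is `⊤`.
  have hcoe : ∀ i, 0 < A.b i →
      (((A.utility M p i).untopD 0 : ℝ) : WithTop ℝ) = A.utility M p i := fun i hb => by
    obtain ⟨c, hc⟩ := WithTop.ne_top_iff_exists.mp (utility_ne_top (M := M) h0 hb)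
    rw [← hc, WithTop.untopD_coe]
  have hle : ∀ i j, M.Adj i j → (A.utility M p i).untopD 0 ≤ p i j := fun i j hij =>
    untopD_utility_le h0 hij
  -- The bound `c` on the buyer's utility is the payoff from a current partner for exchanges, and
  -- zero at an unsaturated buyer for additions.
  have hblock : ∀ k j, A.G.Adj k j → ¬ M.Adj k j → 0 < A.b k → ∀ c : ℝ,
      A.utility M p j ≤ c → A.w s(k, j) ≤ (A.utility M p k).untopD 0 + c := by
    intro k j hG hM hb c hc
    have h1 := (h.not_blocking k j hG hM).trans (add_le_add_right hc _)
    rw [← hcoe k hb] at h1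
    exact_mod_cast h1
  refine ⟨h.isSolution.isBMatching, ?_, ?_, ?_, ?_, ?_⟩
  · intro i hi
    rcases Nat.eq_zero_or_pos (A.b i) with hb | hb
    · rw [utility_eq_top (h.isSolution.isBMatching.2 i) hb, WithTop.untopD_top]
    · have := utility_nonneg (A := A.toMatchingGame) (M := M) h0 i
      rw [← hcoe i hb] at this
      exact_mod_cast this
  · intro i _ hlt
    simp [utility_of_lt hlt]
  · intro i _ j hij
    linarith [hle i j hij, h.isSolution.add_eq i j hij, h0 j i]
  · intro i _ k _ j hij hG hM hb
    have h1 := hblock k j hG hM hb _ (utility_le h0 hij.symm)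
    linarith [hle i j hij, h.isSolution.add_eq i j hij]
  · intro k _ j hG hM hb hlt
    simpa using hblock k j hG hM hb 0 (by simp [utility_of_lt hlt])

theorem exists_isCompetitiveEquilibrium (A : MPA V) :
    ∃ B q, A.IsCompetitiveEquilibrium B q := by
  obtain ⟨M, u, h⟩ := A.exists_isPricing
  obtain ⟨B, hB, -⟩ := h.exists_isCompetitiveEquilibrium
  exact ⟨B, _, hB⟩

end MPA

/-! ### The lattice of equilibrium prices. -/

namespace MPA

section Lattice

variable {V : Type*} {A : MPA V} {B B' : {j // j ∈ A.buyers} → Finset A.Item}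
  {q q' : A.Item → ℝ}

/-- Payments are transfers from buyers to sellers and cancel in the total surplus. -/
theorem sum_bundlePayoff_add_sum_price [DecidableEq A.Item]
    (hB : ∀ j k, j ≠ k → Disjoint (B j) (B k)) (q : A.Item → ℝ) :
    ∑ j, A.bundlePayoff q j (B j) + ∑ x ∈ Finset.univ.biUnion B, q x =
      ∑ j, ∑ x ∈ B j, A.w s((x.1 : V), (j : V)) := by
  rw [Finset.sum_biUnion fun j _ k _ hjk => hB j k hjk, ← Finset.sum_add_distrib]
  exact Finset.sum_congr rfl fun j _ => by simp [bundlePayoff]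

namespace IsCompetitiveEquilibrium

theorem sum_bundlePayoff_add_sum_price (h : A.IsCompetitiveEquilibrium B q) :
    ∑ j, A.bundlePayoff q j (B j) + ∑ x, q x =
      ∑ j, ∑ x ∈ B j, A.w s((x.1 : V), (j : V)) := by
  classical
  rw [← MPA.sum_bundlePayoff_add_sum_price h.disjoint q]
  congr 1
  refine (Finset.sum_subset (Finset.subset_univ _) fun x _ hx => ?_).symm
  exact h.unsold x fun j hj => hx (Finset.mem_biUnion.mpr ⟨j, Finset.mem_univ j, hj⟩)

theorem sum_bundlePayoff_le (h : A.IsCompetitiveEquilibrium B q)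
    (h' : A.IsCompetitiveEquilibrium B' q') :
    ∑ j, A.bundlePayoff q' j (B j) ≤ ∑ j, A.bundlePayoff q' j (B' j) :=
  Finset.sum_le_sum fun j _ => (h'.mem_demand j).2 _ (h.isBundle j)

theorem sum_sold_le [DecidableEq A.Item] (h' : A.IsCompetitiveEquilibrium B' q') :
    ∑ x ∈ Finset.univ.biUnion B, q' x ≤ ∑ x, q' x :=
  Finset.sum_le_sum_of_subset_of_nonneg (Finset.subset_univ _) fun x _ _ => h'.price_nonneg x

theorem welfare_le (h : A.IsCompetitiveEquilibrium B q)
    (h' : A.IsCompetitiveEquilibrium B' q') :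
    ∑ j, ∑ x ∈ B j, A.w s((x.1 : V), (j : V)) ≤
      ∑ j, ∑ x ∈ B' j, A.w s((x.1 : V), (j : V)) := by
  classical
  rw [← MPA.sum_bundlePayoff_add_sum_price h.disjoint q', ← h'.sum_bundlePayoff_add_sum_price]
  exact add_le_add (h.sum_bundlePayoff_le h') h'.sum_sold_le

/-- All equilibrium prices support all equilibrium allocations. -/
theorem of_prices (h : A.IsCompetitiveEquilibrium B q)
    (h' : A.IsCompetitiveEquilibrium B' q') : A.IsCompetitiveEquilibrium B q' := by
  classical
  -- Adding `h4` and `h5` gives the reverse of `h3`, so both are equalities. Hence every `B j` is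
  -- demanded at `q'`, and the items unsold under `B` have price zero.
  have h1 := MPA.sum_bundlePayoff_add_sum_price h.disjoint q'
  have h2 := h'.sum_bundlePayoff_add_sum_price
  have h3 := h'.welfare_le h
  have h4 := h.sum_bundlePayoff_le h'
  have h5 := h'.sum_sold_le (B := B)
  refine ⟨h'.price_nonneg, fun j => ⟨h.isBundle j, fun T hT => ?_⟩, fun x hx => ?_, h.disjoint⟩
  · have h6 := (Finset.sum_eq_sum_iff_of_le fun j _ =>
      (h'.mem_demand j).2 _ (h.isBundle j)).mp (le_antisymm h4 (by linarith))
    rw [h6 j (Finset.mem_univ j)]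
    exact (h'.mem_demand j).2 T hT
  · by_contra hne
    have h6 : ∑ x ∈ Finset.univ.biUnion B, q' x < ∑ x, q' x :=
      Finset.sum_lt_sum_of_subset (Finset.subset_univ _) (Finset.mem_univ x) (by simpa using hx)
        (lt_of_le_of_ne (h'.price_nonneg x) (Ne.symm hne)) fun y _ _ => h'.price_nonneg y
    linarith

theorem price_le_of_mem (h : A.IsCompetitiveEquilibrium B q) {j : {j // j ∈ A.buyers}}
    {x : A.Item} (hx : x ∈ B j) : q x ≤ A.w s((x.1 : V), (j : V)) :=
  (mem_demand_iff.mp (h.mem_demand j)).2.1 x hx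

variable {S : Set (A.Item → ℝ)} {a : A.Item → ℝ}

/-- For a fixed `B`, equilibrium means bounds on single prices and inequalities `q x - q y ≤ c`.
Both survive componentwise suprema. -/
theorem of_isLUB (hS : S.Nonempty) (h : ∀ q ∈ S, A.IsCompetitiveEquilibrium B q)
    (ha : ∀ x, IsLUB ((fun q => q x) '' S) (a x)) : A.IsCompetitiveEquilibrium B a := by
  obtain ⟨r, hr⟩ := hS
  have hle : ∀ q ∈ S, ∀ x, q x ≤ a x := fun q hq x => (ha x).1 ⟨q, hq, rfl⟩
  have hub : ∀ x c, (∀ q ∈ S, q x ≤ c) → a x ≤ c := fun x c hc => (ha x).2 (by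
    rintro _ ⟨q, hq, rfl⟩
    exact hc q hq)
  refine ⟨fun x => ((h r hr).price_nonneg x).trans (hle r hr x), fun j => ?_, fun x hx => ?_,
    (h r hr).disjoint⟩
  · obtain ⟨h1, h2, h3, h4⟩ := mem_demand_iff.mp ((h r hr).mem_demand j)
    refine mem_demand_iff.mpr ⟨h1, fun x hx => hub x _ fun q hq => (h q hq).price_le_of_mem hx,
      fun x hx y hy hz => ?_, fun hb y hy hz => (h4 hb y hy hz).trans (hle r hr y)⟩
    rw [← le_sub_iff_add_le]
    refine hub x _ fun q hq => ?_
    have := (mem_demand_iff.mp ((h q hq).mem_demand j)).2.2.1 x hx y hy hz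
    linarith [hle q hq y]
  · refine le_antisymm (hub x _ fun q hq => ((h q hq).unsold x hx).le) ?_
    exact ((h r hr).price_nonneg x).trans (hle r hr x)

theorem of_isGLB (hS : S.Nonempty) (h : ∀ q ∈ S, A.IsCompetitiveEquilibrium B q)
    (ha : ∀ x, IsGLB ((fun q => q x) '' S) (a x)) : A.IsCompetitiveEquilibrium B a := by
  obtain ⟨r, hr⟩ := hS
  have hle : ∀ q ∈ S, ∀ x, a x ≤ q x := fun q hq x => (ha x).1 ⟨q, hq, rfl⟩
  have hlb : ∀ x c, (∀ q ∈ S, c ≤ q x) → c ≤ a x := fun x c hc => (ha x).2 (by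
    rintro _ ⟨q, hq, rfl⟩
    exact hc q hq)
  have hnonneg : ∀ x, 0 ≤ a x := fun x => hlb x 0 fun q hq => (h q hq).price_nonneg x
  refine ⟨hnonneg, fun j => ?_, fun x hx => ?_, (h r hr).disjoint⟩
  · obtain ⟨h1, h2, h3, h4⟩ := mem_demand_iff.mp ((h r hr).mem_demand j)
    refine mem_demand_iff.mpr ⟨h1, fun x hx => (hle r hr x).trans (h2 x hx),
      fun x hx y hy hz => ?_, fun hb y hy hz => hlb y _ fun q hq =>
        (mem_demand_iff.mp ((h q hq).mem_demand j)).2.2.2 hb y hy hz⟩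
    rw [← sub_le_iff_le_add]
    refine hlb y _ fun q hq => ?_
    have := (mem_demand_iff.mp ((h q hq).mem_demand j)).2.2.1 x hx y hy hz
    linarith [hle q hq x]
  · exact le_antisymm ((hle r hr x).trans ((h r hr).unsold x hx).le) (hnonneg x)

theorem bddAbove_price (h : ∀ q ∈ S, A.IsCompetitiveEquilibrium B q) (x : A.Item) :
    BddAbove ((fun q => q x) '' S) := by
  by_cases hx : ∃ j, x ∈ B j
  · obtain ⟨j, hx⟩ := hx
    refine ⟨A.w s((x.1 : V), (j : V)), ?_⟩
    rintro _ ⟨q, hq, rfl⟩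
    exact (h q hq).price_le_of_mem hx
  · push Not at hx
    refine ⟨0, ?_⟩
    rintro _ ⟨q, hq, rfl⟩
    exact ((h q hq).unsold x hx).le

theorem bddBelow_price (h : ∀ q ∈ S, A.IsCompetitiveEquilibrium B q) (x : A.Item) :
    BddBelow ((fun q => q x) '' S) := by
  refine ⟨0, ?_⟩
  rintro _ ⟨q, hq, rfl⟩
  exact (h q hq).price_nonneg x

end IsCompetitiveEquilibrium

/-- By `of_prices` one allocation serves all prices in `S`, which allows suprema and infima to be
taken with `B` fixed. -/
theorem exists_isCompetitiveEquilibrium_of_subset {S : Set (A.Item → ℝ)} (hS : S.Nonempty)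
    (h : S ⊆ A.equilibriumPrices) : ∃ B, ∀ q ∈ S, A.IsCompetitiveEquilibrium B q := by
  obtain ⟨r, hr⟩ := hS
  obtain ⟨B, hB⟩ := h hr
  refine ⟨B, fun q hq => ?_⟩
  obtain ⟨B', hB'⟩ := h hq
  exact hB.of_prices hB'

theorem exists_isLUB_equilibriumPrices {S : Set A.equilibriumPrices} (hS : S.Nonempty) :
    ∃ a, IsLUB S a := by
  have hS' : (Subtype.val '' S).Nonempty := hS.image _
  obtain ⟨B, hB⟩ := exists_isCompetitiveEquilibrium_of_subset hS' (by
    rintro _ ⟨q, -, rfl⟩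
    exact q.2)
  have ha := fun x => isLUB_csSup (hS'.image fun q => q x)
    (IsCompetitiveEquilibrium.bddAbove_price hB x)
  refine ⟨⟨_, B, IsCompetitiveEquilibrium.of_isLUB hS' hB ha⟩, fun q hq x => ?_,
    fun r hr x => (ha x).2 ?_⟩
  · exact (ha x).1 ⟨q, ⟨q, hq, rfl⟩, rfl⟩
  · rintro _ ⟨_, ⟨q, hq, rfl⟩, rfl⟩
    exact hr hq x

theorem exists_isGLB_equilibriumPrices {S : Set A.equilibriumPrices} (hS : S.Nonempty) :
    ∃ a, IsGLB S a := by
  have hS' : (Subtype.val '' S).Nonempty := hS.image _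
  obtain ⟨B, hB⟩ := exists_isCompetitiveEquilibrium_of_subset hS' (by
    rintro _ ⟨q, -, rfl⟩
    exact q.2)
  have ha := fun x => isGLB_csInf (hS'.image fun q => q x)
    (IsCompetitiveEquilibrium.bddBelow_price hB x)
  refine ⟨⟨_, B, IsCompetitiveEquilibrium.of_isGLB hS' hB ha⟩, fun q hq x => ?_,
    fun r hr x => (ha x).2 ?_⟩
  · exact (ha x).1 ⟨q, ⟨q, hq, rfl⟩, rfl⟩
  · rintro _ ⟨_, ⟨q, hq, rfl⟩, rfl⟩
    exact hr hq x

theorem supClosed_equilibriumPrices (A : MPA V) : SupClosed A.equilibriumPrices := by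
  rintro q ⟨B, hB⟩ q' ⟨B', hB'⟩
  refine ⟨B, IsCompetitiveEquilibrium.of_isLUB (S := {q, q'}) ⟨q, by simp⟩ ?_ fun x => ?_⟩
  · rintro r (rfl | rfl)
    · exact hB
    · exact hB.of_prices hB'
  · rw [Set.image_pair]
    exact isLUB_pair

theorem infClosed_equilibriumPrices (A : MPA V) : InfClosed A.equilibriumPrices := by
  rintro q ⟨B, hB⟩ q' ⟨B', hB'⟩
  refine ⟨B, IsCompetitiveEquilibrium.of_isGLB (S := {q, q'}) ⟨q, by simp⟩ ?_ fun x => ?_⟩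
  · rintro r (rfl | rfl)
    · exact hB
    · exact hB.of_prices hB'
  · rw [Set.image_pair]
    exact isGLB_pair

end Lattice

/-! ### Comparison of payoffs and optimal outcomes. -/

section Order

variable {V : Type*} [Fintype V] {A : MPA V} {B B' : {j // j ∈ A.buyers} → Finset A.Item}
  {q q' q₀ q₁ : A.Item → ℝ}

theorem exists_isLeast_equilibriumPrices (A : MPA V) : ∃ q₀, IsLeast A.equilibriumPrices q₀ := by
  obtain ⟨B, q, h⟩ := A.exists_isCompetitiveEquilibrium
  obtain ⟨a, ha⟩ := exists_isGLB_equilibriumPrices (A := A) (S := Set.univ) ⟨⟨q, B, h⟩, trivial⟩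
  exact ⟨a, a.2, fun r hr => ha.1 (Set.mem_univ (⟨r, hr⟩ : A.equilibriumPrices))⟩

theorem exists_isGreatest_equilibriumPrices (A : MPA V) :
    ∃ q₁, IsGreatest A.equilibriumPrices q₁ := by
  obtain ⟨B, q, h⟩ := A.exists_isCompetitiveEquilibrium
  obtain ⟨a, ha⟩ := exists_isLUB_equilibriumPrices (A := A) (S := Set.univ) ⟨⟨q, B, h⟩, trivial⟩
  exact ⟨a, a.2, fun r hr => ha.1 (Set.mem_univ (⟨r, hr⟩ : A.equilibriumPrices))⟩

/-- Every set of equilibrium prices has a supremum and an infimum. -/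
theorem exists_isLUB_and_exists_isGLB (S : Set A.equilibriumPrices) :
    (∃ a, IsLUB S a) ∧ ∃ a, IsGLB S a := by
  rcases S.eq_empty_or_nonempty with rfl | hS
  · obtain ⟨q₀, h₀⟩ := A.exists_isLeast_equilibriumPrices
    obtain ⟨q₁, h₁⟩ := A.exists_isGreatest_equilibriumPrices
    exact ⟨⟨⟨q₀, h₀.1⟩, by simp, fun r _ => h₀.2 r.2⟩,
      ⟨⟨q₁, h₁.1⟩, by simp, fun r _ => h₁.2 r.2⟩⟩
  · exact ⟨exists_isLUB_equilibriumPrices hS, exists_isGLB_equilibriumPrices hS⟩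

namespace IsCompetitiveEquilibrium

theorem equivalent_iff (h : A.IsCompetitiveEquilibrium B q)
    (h' : A.IsCompetitiveEquilibrium B' q') :
    A.Equivalent (A.matching B) (A.payoff B q) (A.matching B') (A.payoff B' q') ↔ q = q' := by
  rw [h.payoff_eq, h'.payoff_eq]
  constructor
  · intro he
    funext x
    have h1 := he.utility_eq x.1
    rw [h.isPricing.utility_seller x.1.2 (Fin.pos x.2),
      h'.isPricing.utility_seller x.1.2 (Fin.pos x.2)] at h1
    rw [h.price_eq, h'.price_eq]
    exact_mod_cast h1
  · rintro rfl
    exact h.isPricing.equivalent h'.isPricing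

theorem le_iff (h : A.IsCompetitiveEquilibrium B q) (h' : A.IsCompetitiveEquilibrium B' q') :
    q ≤ q' ↔ ∀ i ∈ A.sellers,
      A.totalPayoff (A.payoff B q) i ≤ A.totalPayoff (A.payoff B' q') i := by
  constructor
  · intro hle i hi
    rw [h.totalPayoff_seller hi, h'.totalPayoff_seller hi]
    refine mul_le_mul_of_nonneg_left ?_ (Nat.cast_nonneg _)
    rw [sellerPrice, sellerPrice]
    split_ifs
    · exact hle _
    · exact le_rfl
  · intro hle x
    have h1 := hle x.1 x.1.2
    rw [h.totalPayoff_seller x.1.2, h'.totalPayoff_seller x.1.2] at h1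
    rw [h.price_eq, h'.price_eq]
    exact le_of_mul_le_mul_left h1 (Nat.cast_pos.mpr (Fin.pos x.2))

/-- At the prices `q` the buyer could still choose `B' j`, at no higher cost. -/
theorem buyer_le (h : A.IsCompetitiveEquilibrium B q) (h' : A.IsCompetitiveEquilibrium B' q')
    (hle : q ≤ q') {j : V} (hj : j ∈ A.buyers) :
    A.totalPayoff (A.payoff B' q') j ≤ A.totalPayoff (A.payoff B q) j := by
  rw [h.totalPayoff_buyer ⟨j, hj⟩, h'.totalPayoff_buyer ⟨j, hj⟩]
  refine le_trans ?_ ((h.mem_demand ⟨j, hj⟩).2 _ (h'.isBundle ⟨j, hj⟩))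
  exact Finset.sum_le_sum fun x _ => sub_le_sub_left (hle x) _

theorem isOptimal_sellers_iff (h₁ : IsGreatest A.equilibriumPrices q₁)
    (h : A.IsCompetitiveEquilibrium B q) :
    A.IsOptimalEquilibrium A.sellers B q ↔ q = q₁ := by
  constructor
  · rintro ⟨-, hopt⟩
    obtain ⟨B₁, hB₁⟩ := h₁.1
    refine le_antisymm (h₁.2 ⟨B, h⟩) ((hB₁.le_iff h).mpr fun i hi => ?_)
    by_contra hlt
    exact hopt ⟨B₁, q₁, hB₁, i, hi, not_le.mp hlt⟩
  · rintro rfl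
    refine ⟨h, ?_⟩
    rintro ⟨B', q', h', i, hi, hlt⟩
    exact hlt.not_ge ((h'.le_iff h).mp (h₁.2 ⟨B', h'⟩) i hi)

/-- In a buyer-optimal outcome the buyers together get at least their share at `q₀`. Since welfare
is constant, the prices sum to at most the sum for `q₀`, and `q₀ ≤ q` forces equality. -/
theorem isOptimal_buyers_iff (h₀ : IsLeast A.equilibriumPrices q₀)
    (h : A.IsCompetitiveEquilibrium B q) :
    A.IsOptimalEquilibrium A.buyers B q ↔ q = q₀ := by
  constructor
  · rintro ⟨-, hopt⟩
    obtain ⟨B₀, hB₀⟩ := h₀.1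
    have hle : q₀ ≤ q := h₀.2 ⟨B, h⟩
    have h1 : ∑ j, A.bundlePayoff q₀ j (B₀ j) ≤ ∑ j, A.bundlePayoff q j (B j) := by
      refine Finset.sum_le_sum fun j _ => ?_
      rw [← hB₀.totalPayoff_buyer, ← h.totalPayoff_buyer]
      by_contra hlt
      exact hopt ⟨B₀, q₀, hB₀, j, j.2, not_le.mp hlt⟩
    have h2 := h.sum_bundlePayoff_add_sum_price
    have h3 := hB₀.sum_bundlePayoff_add_sum_price
    have h4 := h.welfare_le hB₀
    have h5 := (Finset.sum_eq_sum_iff_of_le fun x _ => hle x).mp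
      (le_antisymm (Finset.sum_le_sum fun x _ => hle x) (by linarith))
    funext x
    exact (h5 x (Finset.mem_univ x)).symm
  · rintro rfl
    refine ⟨h, ?_⟩
    rintro ⟨B', q', h', i, hi, hlt⟩
    exact hlt.not_ge (h.buyer_le h' (h₀.2 ⟨B', h'⟩) hi)

end IsCompetitiveEquilibrium

end Order

/-! ### Buyer-optimal stable solutions. -/

section Stable

variable {V : Type*} [Fintype V] {A : MPA V} {M : SimpleGraph V} {p : V → V → ℝ}

/-- Every stable solution is dominated, from the point of view of the buyers, by a competitive
equilibrium outcome with the same matching. -/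
theorem exists_isCompetitiveEquilibrium_of_isStable (h : A.IsStable M p) :
    ∃ B q, A.IsCompetitiveEquilibrium B q ∧ A.matching B = M ∧
      ∀ j ∈ A.buyers, ∀ i, p j i ≤ A.payoff B q j i := by
  have hu := isPricing_of_isStable h
  obtain ⟨B, hB, hBM⟩ := hu.exists_isCompetitiveEquilibrium
  refine ⟨B, _, hB, hBM, fun j hj i => ?_⟩
  rw [hB.payoff_eq, hBM]
  by_cases hji : M.Adj j i
  · have hi := hu.mem_sellers hj hji
    rw [pricePayoff_buyer hj hji, sellerPrice, dif_pos ⟨hi, hu.pos_of_adj hji.symm⟩]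
    -- The seller's payoff on this edge is at least its utility, which is the new price.
    linarith [untopD_utility_le (A := A.toMatchingGame) h.isSolution.nonneg hji.symm,
      h.isSolution.add_eq i j hji.symm]
  · rw [pricePayoff_of_not_adj hji, h.isSolution.eq_zero j i hji]

theorem totalPayoff_le_of_le {p' : V → V → ℝ} {j : V} (h : ∀ i, p j i ≤ p' j i) :
    A.totalPayoff p j ≤ A.totalPayoff p' j :=
  Finset.sum_le_sum fun i _ => h i

theorem exists_isOptimalStable_buyers (A : MPA V) : ∃ M p, A.IsOptimalStable A.buyers M p := by
  obtain ⟨q₀, ⟨B, hB⟩, hq₀⟩ := A.exists_isLeast_equilibriumPrices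
  refine ⟨_, _, hB.isStable, ?_⟩
  rintro ⟨M', p', hM', j, hj, hlt⟩
  obtain ⟨B', q', hB', -, hle⟩ := exists_isCompetitiveEquilibrium_of_isStable hM'
  exact hlt.not_ge ((totalPayoff_le_of_le (hle j hj)).trans
    (hB.buyer_le hB' (hq₀ ⟨B', hB'⟩) hj))

/-- A buyer-optimal stable solution is induced by a competitive equilibrium outcome. -/
theorem exists_payoff_eq_of_isOptimalStable (h : A.IsOptimalStable A.buyers M p) :
    ∃ B q, A.IsOptimalEquilibrium A.buyers B q ∧ A.matching B = M ∧ A.payoff B q = p := by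
  classical
  obtain ⟨B, q, hB, hBM, hle⟩ := exists_isCompetitiveEquilibrium_of_isStable h.1
  have hS := hB.isStable.isSolution
  have hsol := h.1.isSolution
  have hbuyer : ∀ j ∈ A.buyers, ∀ i, A.payoff B q j i = p j i := by
    intro j hj i
    by_cases hji : M.Adj j i
    -- The equilibrium dominates `p` termwise for `j`, while optimality of `p` forbids a larger
    -- total, so all terms agree.
    · have htot : A.totalPayoff p j = A.totalPayoff (A.payoff B q) j := by
        refine le_antisymm (totalPayoff_le_of_le (hle j hj)) (not_lt.mp fun hlt => ?_)
        exact h.2 ⟨_, _, hB.isStable, j, hj, hlt⟩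
      have := (Finset.sum_eq_sum_iff_of_le fun i _ => hle j hj i).mp htot i
        (Finset.mem_filter.mpr ⟨Finset.mem_univ i, hsol.isBMatching.1 hji⟩)
      exact this.symm
    · rw [hS.eq_zero j i (hBM ▸ hji), hsol.eq_zero j i hji]
  have hp : A.payoff B q = p := by
    funext i j
    rcases A.cover i with hi | hi
    · by_cases hij : M.Adj i j
      · have hj := mem_buyers_of_adj (hsol.isBMatching.1 hij) hi
        have h1 := hS.add_eq i j (hBM ▸ hij)
        rw [hbuyer j hj] at h1
        linarith [hsol.add_eq i j hij]
      · rw [hS.eq_zero i j (hBM ▸ hij), hsol.eq_zero i j hij]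
    · exact hbuyer i hi j
  refine ⟨B, q, ⟨hB, ?_⟩, hBM, hp⟩
  rintro ⟨B', q', hB', j, hj, hlt⟩
  exact h.2 ⟨_, _, hB'.isStable, j, hj, hp ▸ hlt⟩

/-- Both are buyer-optimal equilibrium outcomes, hence have the same least prices. -/
theorem equivalent_of_isOptimal {B : {j // j ∈ A.buyers} → Finset A.Item} {q : A.Item → ℝ}
    (h : A.IsOptimalStable A.buyers M p) (hB : A.IsOptimalEquilibrium A.buyers B q) :
    A.Equivalent M p (A.matching B) (A.payoff B q) := by
  obtain ⟨B', q', hB', rfl, rfl⟩ := exists_payoff_eq_of_isOptimalStable h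
  obtain ⟨q₀, hq₀⟩ := A.exists_isLeast_equilibriumPrices
  rw [hB'.1.equivalent_iff hB.1, (hB'.1.isOptimal_buyers_iff hq₀).mp hB',
    (hB.1.isOptimal_buyers_iff hq₀).mp hB]

end Stable

end MPA

end

theorem theorem11 {V : Type*} [Fintype V] (A : MPA V) :
    -- two equilibrium outcomes are equivalent iff their prices agree, and comparing the prices
    -- is comparing the payoffs of the sellers (and, reversed, compares those of the buyers)
    (∀ B q B' q', A.IsCompetitiveEquilibrium B q → A.IsCompetitiveEquilibrium B' q' →
      (A.Equivalent (A.matching B) (A.payoff B q) (A.matching B') (A.payoff B' q') ↔ q = q') ∧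
      (q ≤ q' ↔ ∀ i ∈ A.sellers,
        A.totalPayoff (A.payoff B q) i ≤ A.totalPayoff (A.payoff B' q') i) ∧
      (q ≤ q' → ∀ j ∈ A.buyers,
        A.totalPayoff (A.payoff B' q') j ≤ A.totalPayoff (A.payoff B q) j)) ∧
    -- complete lattice, with componentwise maximum and minimum as its binary operations
    (∀ S : Set A.equilibriumPrices, (∃ a, IsLUB S a) ∧ (∃ a, IsGLB S a)) ∧
    SupClosed A.equilibriumPrices ∧ InfClosed A.equilibriumPrices ∧
    -- unique optimal outcomes for the buyers and for the sellers
    (∃ q₀, IsLeast A.equilibriumPrices q₀ ∧ ∀ B q, A.IsCompetitiveEquilibrium B q →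
      (A.IsOptimalEquilibrium A.buyers B q ↔ q = q₀)) ∧
    (∃ q₁, IsGreatest A.equilibriumPrices q₁ ∧ ∀ B q, A.IsCompetitiveEquilibrium B q →
      (A.IsOptimalEquilibrium A.sellers B q ↔ q = q₁)) ∧
    -- competitive equilibrium outcomes are stable solutions
    (∀ B q, A.IsCompetitiveEquilibrium B q → A.IsStable (A.matching B) (A.payoff B q)) ∧
    -- the buyer-optimal stable solution and the buyer-optimal equilibrium outcome are equivalent
    (∃ M p, A.IsOptimalStable A.buyers M p) ∧
    (∀ M p B q, A.IsOptimalStable A.buyers M p → A.IsOptimalEquilibrium A.buyers B q →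
      A.Equivalent M p (A.matching B) (A.payoff B q)) := by
  obtain ⟨q₀, h₀⟩ := A.exists_isLeast_equilibriumPrices
  obtain ⟨q₁, h₁⟩ := A.exists_isGreatest_equilibriumPrices
  exact ⟨fun _ _ _ _ h h' => ⟨h.equivalent_iff h', h.le_iff h', fun hle _ hj =>
      h.buyer_le h' hle hj⟩,
    MPA.exists_isLUB_and_exists_isGLB, A.supClosed_equilibriumPrices,
    A.infClosed_equilibriumPrices, ⟨q₀, h₀, fun _ _ h => h.isOptimal_buyers_iff h₀⟩,
    ⟨q₁, h₁, fun _ _ h => h.isOptimal_sellers_iff h₁⟩, fun _ _ h => h.isStable,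
    A.exists_isOptimalStable_buyers, fun _ _ _ _ h hB => MPA.equivalent_of_isOptimal h hB⟩
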